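/- All algebras are over $\mathbb{C}$, not necessarily associative or unital. A Novikov algebra is an algebra satisfying $(xy)z=(xz)y$ and $(xy)z-x(yz)=(yx)z-y(xz)$. It is nilpotent if some power vanishes, where $A^1=A$ and $A^n=\sum_{i+j=n,\ i,j\ge 1}A^iA^j$ for $n\geq 2$; it is one-generated if it is generated as an algebra by a single element. \textbf{Theorem.} Every $5$-dimensional complex one-generated nilpotent Novikov algebra is isomorphic to one of the following algebras with basis $e_1,\dots,e_5$, for some values $\lambda,\mu\in\mathbb{C}$ of the parameters (products of basis elements that are not listed are zero); conversely, every algebra in this list is a $5$-dimensional one-generated nilpotent Novikov algebra. - $\mathcal N^5_{01}$: $e_1e_1=e_2,\ e_1e_2=e_4,\ e_1e_3=e_5,\ e_2e_1=e_3,\ e_3e_1=-e_5$; - $\mathcal N^5_{02}(\lambda)$: $e_1e_1=e_2,\ e_1e_2=e_3,\ e_1e_3=(2-\lambda)e_5,\ e_2e_1=\lambda e_3+e_4,\ e_2e_2=\lambda e_5,\ e_3e_1=\lambda e_5$; - $\mathcal N^5_{03}(\lambda,\mu)$: $e_1e_1=e_2,\ e_1e_2=e_3,\ e_1e_3=\lambda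 e_5,\ e_1e_4=\mu e_5,\ e_2e_1=e_4,\ e_2e_2=e_5,\ e_3e_1=e_5,\ e_4e_1=(2-\mu)e_5$; - $\mathcal N^5_{04}(\lambda)$, $\lambda\neq 0$: $e_1e_1=e_2,\ e_1e_2=e_3,\ e_1e_3=e_5,\ e_1e_4=\lambda e_5,\ e_2e_1=e_4,\ e_4e_1=-\lambda e_5$; - $\mathcal N^5_{05}$: $e_1e_1=e_2,\ e_1e_3=e_4,\ e_1e_4=2e_5,\ e_2e_1=e_3,\ e_2e_3=-e_5,\ e_3e_1=-e_4,\ e_4e_1=-e_5$; - $\mathcal N^5_{06}$: $e_1e_1=e_2,\ e_1e_2=e_5,\ e_1e_3=e_4,\ e_1e_4=2e_5,\ e_2e_1=e_3,\ e_2e_3=-e_5,\ e_3e_1=-e_4,\ e_4e_1=-e_5$; - $\mathcal N^5_{07}(\lambda)$: $e_1e_1=e_2,\ e_1e_2=e_3,\ e_1e_3=(2-\lambda)e_4,\ e_1e_4=(3-2\lambda)e_5,\ e_2e_1=\lambda e_3,\ e_2e_2=\lambda e_4,\ e_2e_3=\lambda(2-\lambda)e_5,\ e_3e_1=\lambda e_4,\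 e_3e_2=\lambda e_5,\ e_4e_1=\lambda e_5$; - $\mathcal N^5_{08}$: $e_1e_1=e_2,\ e_1e_2=e_3,\ e_1e_3=e_4,\ e_1e_4=e_5,\ e_2e_1=e_5$; - $\mathcal N^5_{09}(\lambda)$: $e_1e_1=e_2,\ e_1e_2=e_3,\ e_1e_3=2e_4,\ e_1e_4=\lambda e_5,\ e_2e_3=2e_5,\ e_3e_2=-2e_5,\ e_4e_1=e_5$; - $\mathcal N^5_{10}$: $e_1e_1=e_2,\ e_1e_2=e_3,\ e_1e_3=e_4,\ e_1e_4=e_5,\ e_2e_1=e_3+e_5,\ e_2e_2=e_4,\ e_2e_3=e_5,\ e_3e_1=e_4,\ e_3e_2=e_5,\ e_4e_1=e_5$; - $\mathcal N^5_{11}(\lambda)$: $e_1e_1=e_2,\ e_1e_2=e_3,\ e_1e_3=2e_4+\lambda e_5,\ e_1e_4=2e_5,\ e_2e_1=e_4,\ e_2e_2=e_5,\ e_3e_1=e_5$; - $\mathcal N^5_{12}(\lambda)$: $e_1e_1=e_2,\ e_1e_2=e_3,\ e_1e_3=2e_4,\ e_1e_4=(2\lambda+1)e_5,\ e_2e_1=e_4,\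 e_2e_2=\lambda e_5,\ e_2e_3=-2e_5,\ e_3e_1=\lambda e_5,\ e_3e_2=2e_5,\ e_4e_1=-e_5$; - $\mathcal N^5_{13}(\lambda)$: $e_1e_1=e_2,\ e_1e_2=e_3,\ e_1e_3=e_4-2e_5,\ e_1e_4=e_5,\ e_2e_1=e_3+e_4+\lambda e_5,\ e_2e_2=e_4,\ e_2e_3=e_5,\ e_3e_1=e_4,\ e_3e_2=e_5,\ e_4e_1=e_5$. -/

import Mathlib

namespace NovikovClassification

section Notions

variable (A : Type*) [NonUnitalNonAssocRing A] [Module ℂ A]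

/-- The two defining identities of Novikov algebras: right commutativity and left symmetry. -/
structure IsNovikov (A : Type*) [NonUnitalNonAssocRing A] : Prop where
  right_comm : ∀ x y z : A, (x * y) * z = (x * z) * y
  left_symm : ∀ x y z : A, (x * y) * z - x * (y * z) = (y * x) * z - y * (x * z)

variable [IsScalarTower ℂ A A] [SMulCommClass ℂ A A]

/-- The powers of a nonassociative algebra: `A ^ 1 = A` and
`A ^ n = ∑_{i + j = n, i, j ≥ 1} A ^ i * A ^ j` for `n ≥ 2`, where the product of two subspaces is
the span of all products (by convention `A ^ 0 = A`). -/
noncomputable def algPow : ℕ → Submodule ℂ A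
  | 0 => ⊤
  | 1 => ⊤
  | n + 2 => ⨆ i : Fin (n + 1),
      Submodule.map₂ (LinearMap.mul ℂ A) (algPow (i.val + 1)) (algPow (n + 1 - i.val))
  termination_by n => n
  decreasing_by all_goals omega

/-- A (nonassociative) algebra is nilpotent if one of its powers vanishes. -/
def IsNilpotentAlgebra : Prop := ∃ n : ℕ, algPow A n = ⊥

/-- An algebra is one-generated if it is generated, as a nonunital algebra, by one element. -/
def IsOneGenerated : Prop := ∃ a : A, NonUnitalAlgebra.adjoin ℂ {a} = ⊤

end Notions

/-- Multiplication tables on a five-dimensional space with basis `e₁, …, e₅`: the entry in row `i`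
and column `j` (counted from `1` in the mathematics, from `0` in `Fin 5`) is the product `eᵢ eⱼ`. -/
abbrev MulTable := Matrix (Fin 5) (Fin 5) (Fin 5 → ℂ)

/-- The algebra with underlying space `ℂ⁵` whose product is the bilinear extension of `T`. -/
def TableAlgebra (_T : MulTable) : Type := Fin 5 → ℂ

namespace TableAlgebra

variable (T : MulTable)

instance : AddCommGroup (TableAlgebra T) := inferInstanceAs (AddCommGroup (Fin 5 → ℂ))

instance : Module ℂ (TableAlgebra T) := inferInstanceAs (Module ℂ (Fin 5 → ℂ))

/-- The bilinear extension of the table `T`. -/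
noncomputable def tableMul (x y : Fin 5 → ℂ) : Fin 5 → ℂ :=
  ∑ i, ∑ j, (x i * y j) • T i j

theorem tableMul_add (x y z : Fin 5 → ℂ) :
    tableMul T x (y + z) = tableMul T x y + tableMul T x z := by
  simp only [tableMul, Pi.add_apply, mul_add, add_smul, Finset.sum_add_distrib]

theorem add_tableMul (x y z : Fin 5 → ℂ) :
    tableMul T (x + y) z = tableMul T x z + tableMul T y z := by
  simp only [tableMul, Pi.add_apply, add_mul, add_smul, Finset.sum_add_distrib]

theorem smul_tableMul (c : ℂ) (x y : Fin 5 → ℂ) :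
    tableMul T (c • x) y = c • tableMul T x y := by
  simp only [tableMul, Pi.smul_apply, smul_eq_mul, Finset.smul_sum, smul_smul, mul_assoc]

theorem tableMul_smul (c : ℂ) (x y : Fin 5 → ℂ) :
    tableMul T x (c • y) = c • tableMul T x y := by
  simp only [tableMul, Pi.smul_apply, smul_eq_mul, Finset.smul_sum, smul_smul, mul_left_comm]

theorem zero_tableMul (x : Fin 5 → ℂ) : tableMul T 0 x = 0 := by
  simp [tableMul]

theorem tableMul_zero (x : Fin 5 → ℂ) : tableMul T x 0 = 0 := by
  simp [tableMul]

noncomputable instance : NonUnitalNonAssocRing (TableAlgebra T) where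
  mul x y := tableMul T x y
  left_distrib := tableMul_add T
  right_distrib := add_tableMul T
  zero_mul := zero_tableMul T
  mul_zero := tableMul_zero T

instance : IsScalarTower ℂ (TableAlgebra T) (TableAlgebra T) :=
  ⟨smul_tableMul T⟩

instance : SMulCommClass ℂ (TableAlgebra T) (TableAlgebra T) :=
  ⟨fun c x y => (tableMul_smul T c x y).symm⟩

end TableAlgebra

/-- `A` is isomorphic, as a complex algebra, to the algebra with multiplication table `T`. -/
def IsoToTable (A : Type*) [NonUnitalNonAssocRing A] [Module ℂ A] (T : MulTable) : Prop :=
  ∃ f : A ≃ₗ[ℂ] TableAlgebra T, ∀ x y : A, f (x * y) = f x * f y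

/-- The second vector of the standard basis of `ℂ⁵`. -/
def e₂ : Fin 5 → ℂ := ![0, 1, 0, 0, 0]

/-- The third vector of the standard basis of `ℂ⁵`. -/
def e₃ : Fin 5 → ℂ := ![0, 0, 1, 0, 0]

/-- The fourth vector of the standard basis of `ℂ⁵`. -/
def e₄ : Fin 5 → ℂ := ![0, 0, 0, 1, 0]

/-- The fifth vector of the standard basis of `ℂ⁵`. -/
def e₅ : Fin 5 → ℂ := ![0, 0, 0, 0, 1]

noncomputable section Tables

def N01 : MulTable :=
  !![e₂, e₄, e₅, 0, 0;
     e₃, 0, 0, 0, 0;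
     -e₅, 0, 0, 0, 0;
     0, 0, 0, 0, 0;
     0, 0, 0, 0, 0]

def N02 (l : ℂ) : MulTable :=
  !![e₂, e₃, (2 - l) • e₅, 0, 0;
     l • e₃ + e₄, l • e₅, 0, 0, 0;
     l • e₅, 0, 0, 0, 0;
     0, 0, 0, 0, 0;
     0, 0, 0, 0, 0]

def N03 (l m : ℂ) : MulTable :=
  !![e₂, e₃, l • e₅, m • e₅, 0;
     e₄, e₅, 0, 0, 0;
     e₅, 0, 0, 0, 0;
     (2 - m) • e₅, 0, 0, 0, 0;
     0, 0, 0, 0, 0]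

def N04 (l : ℂ) : MulTable :=
  !![e₂, e₃, e₅, l • e₅, 0;
     e₄, 0, 0, 0, 0;
     0, 0, 0, 0, 0;
     -(l • e₅), 0, 0, 0, 0;
     0, 0, 0, 0, 0]

def N05 : MulTable :=
  !![e₂, 0, e₄, (2 : ℂ) • e₅, 0;
     e₃, 0, -e₅, 0, 0;
     -e₄, 0, 0, 0, 0;
     -e₅, 0, 0, 0, 0;
     0, 0, 0, 0, 0]

def N06 : MulTable :=
  !![e₂, e₅, e₄, (2 : ℂ) • e₅, 0;
     e₃, 0, -e₅, 0, 0;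
     -e₄, 0, 0, 0, 0;
     -e₅, 0, 0, 0, 0;
     0, 0, 0, 0, 0]

def N07 (l : ℂ) : MulTable :=
  !![e₂, e₃, (2 - l) • e₄, (3 - 2 * l) • e₅, 0;
     l • e₃, l • e₄, (l * (2 - l)) • e₅, 0, 0;
     l • e₄, l • e₅, 0, 0, 0;
     l • e₅, 0, 0, 0, 0;
     0, 0, 0, 0, 0]

def N08 : MulTable :=
  !![e₂, e₃, e₄, e₅, 0;
     e₅, 0, 0, 0, 0;
     0, 0, 0, 0, 0;
     0, 0, 0, 0, 0;
     0, 0, 0, 0, 0]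

def N09 (l : ℂ) : MulTable :=
  !![e₂, e₃, (2 : ℂ) • e₄, l • e₅, 0;
     0, 0, (2 : ℂ) • e₅, 0, 0;
     0, (-2 : ℂ) • e₅, 0, 0, 0;
     e₅, 0, 0, 0, 0;
     0, 0, 0, 0, 0]

def N10 : MulTable :=
  !![e₂, e₃, e₄, e₅, 0;
     e₃ + e₅, e₄, e₅, 0, 0;
     e₄, e₅, 0, 0, 0;
     e₅, 0, 0, 0, 0;
     0, 0, 0, 0, 0]

def N11 (l : ℂ) : MulTable :=
  !![e₂, e₃, (2 : ℂ) • e₄ + l • e₅, (2 : ℂ) • e₅, 0;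
     e₄, e₅, 0, 0, 0;
     e₅, 0, 0, 0, 0;
     0, 0, 0, 0, 0;
     0, 0, 0, 0, 0]

def N12 (l : ℂ) : MulTable :=
  !![e₂, e₃, (2 : ℂ) • e₄, (2 * l + 1) • e₅, 0;
     e₄, l • e₅, (-2 : ℂ) • e₅, 0, 0;
     l • e₅, (2 : ℂ) • e₅, 0, 0, 0;
     -e₅, 0, 0, 0, 0;
     0, 0, 0, 0, 0]

def N13 (l : ℂ) : MulTable :=
  !![e₂, e₃, e₄ - (2 : ℂ) • e₅, e₅, 0;
     e₃ + e₄ + l • e₅, e₄, e₅, 0, 0;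
     e₄, e₅, 0, 0, 0;
     e₅, 0, 0, 0, 0;
     0, 0, 0, 0, 0]

end Tables

end NovikovClassification

/-! Let `L 0 = A` and `L (n+1) = A (L n) + (L n) A` (`lowerPow`). The Novikov identities make this a
graded filtration, `L i * L j ⊆ L (i+j+1)` (`mul_mem_lowerPow`). Nilpotency makes it strictly
decreasing until it vanishes, so in dimension 5 the dimension of `L n` is at most `5 - n`. If `a`
generates, every element is a multiple of `a` modulo `L 1`, so each layer is obtained from the
previous one by multiplying with `a` on either side (`lowerPow_succ_le_sup`).

Hence `L 2` is spanned modulo `L 3` by `a(aa)` and `(aa)a`, and three cases arise. If these are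
independent modulo `L 3`, then `L 4 = 0` and `dim L 3 ≤ 1` (`isListed_of_wide`). Otherwise `(aa)a ≡
l a(aa)` for some `l` (`isListed_of_ratio`), or `a(aa) ≡ 0` (`isListed_of_infty_ratio`); in both,
every layer is a line. The identities, evaluated on a basis adapted to the layers, then fix the
multiplication table up to a few parameters: `wideTable`, `ratioTable` for `l ≠ 0`, `zeroRatioTable`
for `l = 0`, and `inftyRatioTable`.

The parameters are normalised by replacing the generator `e₁` with `e₁ + s e₂` or `e₁ + w e₃`, which
removes terms, and with `t e₁`, which rescales what is left; square roots exist over ℂ. Every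
outcome is one of the listed tables.

Conversely, on each listed table the Novikov identities are polynomial identities in coordinates,
nilpotency follows from triangularity of the product, and generation from the fact that each later
basis vector is a combination of products of earlier ones. -/

namespace NovikovClassification

/-! ### The filtration by one-sided products, and its comparison with the powers of the algebra -/

section LowerPowers

variable (A : Type*) [NonUnitalNonAssocRing A] [Module ℂ A]
  [IsScalarTower ℂ A A] [SMulCommClass ℂ A A]

/-- The descending chain `A ⊇ A A ⊇ A (A A) + (A A) A ⊇ ⋯` of iterated products with `A`. -/
noncomputable def lowerPow : ℕ → Submodule ℂ A
  | 0 => ⊤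
  | n + 1 => Submodule.map₂ (LinearMap.mul ℂ A) ⊤ (lowerPow n) ⊔
      Submodule.map₂ (LinearMap.mul ℂ A) (lowerPow n) ⊤

variable {A}

theorem mem_lowerPow_zero (x : A) : x ∈ lowerPow A 0 := Submodule.mem_top

theorem mul_mem_lowerPow_succ_left (x : A) {y : A} {n : ℕ} (hy : y ∈ lowerPow A n) :
    x * y ∈ lowerPow A (n + 1) :=
  Submodule.mem_sup_left
    (Submodule.apply_mem_map₂ (LinearMap.mul ℂ A) (Submodule.mem_top (x := x)) hy)

theorem mul_mem_lowerPow_succ_right {x : A} (y : A) {n : ℕ} (hx : x ∈ lowerPow A n) :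
    x * y ∈ lowerPow A (n + 1) :=
  Submodule.mem_sup_right
    (Submodule.apply_mem_map₂ (LinearMap.mul ℂ A) hx (Submodule.mem_top (x := y)))

theorem lowerPow_succ_le {n : ℕ} {W : Submodule ℂ A}
    (hl : ∀ x : A, ∀ y ∈ lowerPow A n, x * y ∈ W)
    (hr : ∀ x ∈ lowerPow A n, ∀ y : A, x * y ∈ W) : lowerPow A (n + 1) ≤ W :=
  sup_le (Submodule.map₂_le.2 fun x _ y hy => hl x y hy)
    (Submodule.map₂_le.2 fun x hx y _ => hr x hx y)

theorem lowerPow_succ_le_self (n : ℕ) : lowerPow A (n + 1) ≤ lowerPow A n := by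
  induction n with
  | zero => exact le_top
  | succ n ih =>
    exact lowerPow_succ_le (fun x y hy => mul_mem_lowerPow_succ_left x (ih hy))
      (fun x hx y => mul_mem_lowerPow_succ_right y (ih hx))

theorem lowerPow_antitone : Antitone (lowerPow A) :=
  antitone_nat_of_succ_le lowerPow_succ_le_self

/-- Induction on `j`, both sides at once. For a generator `uv` of the next layer, left symmetry
expands `x(uv)` as `(xu)v - (ux)v + u(xv)`, and right commutativity turns `(uv)x` into `(ux)v`. Each
resulting term multiplies `x` by the deeper of `u`, `v` and by the other one separately, so the
inductive hypothesis applies. -/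
theorem mul_mem_lowerPow (h : IsNovikov A) {j : ℕ} : ∀ {i : ℕ} {x y : A}, x ∈ lowerPow A i →
    y ∈ lowerPow A j → x * y ∈ lowerPow A (i + j + 1) ∧ y * x ∈ lowerPow A (i + j + 1) := by
  induction j with
  | zero =>
    intro i x y hx _
    exact ⟨mul_mem_lowerPow_succ_right y hx, mul_mem_lowerPow_succ_left y hx⟩
  | succ j ih =>
    intro i x y hx hy
    have key : lowerPow A (j + 1) ≤
        (lowerPow A (i + (j + 1) + 1)).comap (LinearMap.mulLeft ℂ x) ⊓
          (lowerPow A (i + (j + 1) + 1)).comap (LinearMap.mulRight ℂ x) := by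
      have e : i + 1 + j + 1 = i + (j + 1) + 1 := by omega
      refine lowerPow_succ_le (fun u v hv => ?_) (fun u hu v => ?_)
      · simp only [Submodule.mem_inf, Submodule.mem_comap, LinearMap.mulLeft_apply,
          LinearMap.mulRight_apply]
        constructor
        · have e1 : x * (u * v) = (x * u) * v - (u * x) * v + u * (x * v) := by
            rw [h.left_symm x u v |> sub_eq_iff_eq_add.1]
            abel
          rw [e1]
          refine add_mem (sub_mem ?_ ?_) ?_
          · exact e ▸ (ih (mul_mem_lowerPow_succ_right u hx) hv).1
          · exact e ▸ (ih (mul_mem_lowerPow_succ_left u hx) hv).1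
          · exact mul_mem_lowerPow_succ_left u (ih hx hv).1
        · rw [h.right_comm]
          exact e ▸ (ih (mul_mem_lowerPow_succ_left u hx) hv).1
      · simp only [Submodule.mem_inf, Submodule.mem_comap, LinearMap.mulLeft_apply,
          LinearMap.mulRight_apply]
        constructor
        · have e1 : x * (u * v) = (x * u) * v - (u * x) * v + u * (x * v) := by
            rw [h.left_symm x u v |> sub_eq_iff_eq_add.1]
            abel
          rw [e1]
          refine add_mem (sub_mem ?_ ?_) ?_
          · exact mul_mem_lowerPow_succ_right v (ih hx hu).1
          · exact mul_mem_lowerPow_succ_right v (ih hx hu).2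
          · exact e ▸ (ih (mul_mem_lowerPow_succ_right v hx) hu).2
        · rw [h.right_comm]
          exact mul_mem_lowerPow_succ_right v (ih hx hu).2
    exact key hy

theorem mul_mem_lowerPow_of_le (h : IsNovikov A) {i j n : ℕ} {x y : A} (hx : x ∈ lowerPow A i)
    (hy : y ∈ lowerPow A j) (hn : n ≤ i + j + 1) : x * y ∈ lowerPow A n :=
  lowerPow_antitone hn (mul_mem_lowerPow h hx hy).1

theorem map₂_mul_algPow_le {i j n : ℕ} (h : i + j = n) :
    Submodule.map₂ (LinearMap.mul ℂ A) (algPow A (i + 1)) (algPow A (j + 1)) ≤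
      algPow A (n + 2) := by
  subst h
  rw [algPow.eq_3]
  refine le_trans (le_of_eq ?_) (le_iSup _ (⟨i, by omega⟩ : Fin (i + j + 1)))
  have : i + j + 1 - i = j + 1 := by omega
  simp only [this]

theorem lowerPow_le_algPow (n : ℕ) : lowerPow A n ≤ algPow A (n + 1) := by
  induction n with
  | zero => rw [zero_add, algPow.eq_2]; exact le_top
  | succ n ih =>
    have h1 : (⊤ : Submodule ℂ A) = algPow A (0 + 1) := by rw [zero_add, algPow.eq_2]
    rw [lowerPow, h1]
    exact sup_le ((Submodule.map₂_le_map₂_right ih).trans (map₂_mul_algPow_le (by omega)))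
      ((Submodule.map₂_le_map₂_left ih).trans (map₂_mul_algPow_le (by omega)))

/-- When `i + j ≥ 2 ^ (k+1)`, one of `i`, `j` is at least `2 ^ k`. Since multiplying by an arbitrary
element already gains one step of `F`, only that factor has to be controlled. -/
theorem algPow_le_of_filtration (F : ℕ → Submodule ℂ A) (h0 : F 0 = ⊤)
    (hl : ∀ k x y, y ∈ F k → x * y ∈ F (k + 1)) (hr : ∀ k x y, x ∈ F k → x * y ∈ F (k + 1))
    (k : ℕ) : ∀ n, 2 ^ k ≤ n → algPow A n ≤ F k := by
  induction k with
  | zero => intro n _; rw [h0]; exact le_top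
  | succ k ih =>
    intro n hn
    have hk : 1 ≤ 2 ^ k := Nat.one_le_two_pow
    rw [pow_succ] at hn
    obtain ⟨m, rfl⟩ : ∃ m, n = m + 2 := ⟨n - 2, by omega⟩
    rw [algPow.eq_3]
    refine iSup_le fun i => Submodule.map₂_le.2 fun x hx y hy => ?_
    have hi := i.2
    by_cases hc : 2 ^ k ≤ i.val + 1
    · exact hr _ _ _ (ih _ hc hx)
    · exact hl _ _ _ (ih _ (by omega) hy)

theorem lowerPow_eq_bot_of_isNilpotentAlgebra (h : IsNilpotentAlgebra A) :
    ∃ n, lowerPow A n = ⊥ := by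
  obtain ⟨n, hn⟩ := h
  -- The convention `algPow A 0 = ⊤` makes index `0` possible only when `A` is trivial.
  rcases n with _ | n
  · refine ⟨0, ?_⟩
    rw [algPow.eq_1] at hn
    rw [lowerPow, hn]
  · exact ⟨n, le_bot_iff.1 (hn ▸ lowerPow_le_algPow n)⟩

/-- Each term depends only on the preceding one, so a single repetition makes the chain constant
from there on, and nilpotency makes that constant zero. -/
theorem lowerPow_succ_lt (h : IsNilpotentAlgebra A) {n : ℕ} (hn : lowerPow A n ≠ ⊥) :
    lowerPow A (n + 1) < lowerPow A n := by
  refine lt_of_le_of_ne (lowerPow_succ_le_self n) fun he => hn ?_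
  have hs : ∀ k, lowerPow A (n + k) = lowerPow A n := by
    intro k
    induction k with
    | zero => rfl
    | succ k ih =>
      rw [← add_assoc, lowerPow, ih, ← lowerPow.eq_2, he]
  obtain ⟨N, hN⟩ := lowerPow_eq_bot_of_isNilpotentAlgebra h
  rw [← hs N, eq_bot_iff, ← hN]
  exact lowerPow_antitone (by omega)

theorem finrank_lowerPow_succ_le [FiniteDimensional ℂ A] (h : IsNilpotentAlgebra A) (n : ℕ) :
    Module.finrank ℂ (lowerPow A (n + 1)) ≤ Module.finrank ℂ (lowerPow A n) - 1 := by
  by_cases hn : lowerPow A n = ⊥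
  · have : lowerPow A (n + 1) = ⊥ := le_bot_iff.1 (hn ▸ lowerPow_succ_le_self n)
    rw [this, finrank_bot]
    exact Nat.zero_le _
  · have := Submodule.finrank_lt_finrank_of_lt (lowerPow_succ_lt h hn)
    omega

theorem exists_sub_smul_mem_lowerPow_one {a : A} (ha : NonUnitalAlgebra.adjoin ℂ {a} = ⊤)
    (x : A) : ∃ c : ℂ, x - c • a ∈ lowerPow A 1 := by
  have hx : x ∈ NonUnitalAlgebra.adjoin ℂ {a} := by rw [ha]; trivial
  induction hx using NonUnitalAlgebra.adjoin_induction with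
  | mem x hx =>
    rw [Set.mem_singleton_iff] at hx
    exact ⟨1, by simp [hx]⟩
  | add x y _ _ hx hy =>
    obtain ⟨c, hc⟩ := hx
    obtain ⟨d, hd⟩ := hy
    refine ⟨c + d, ?_⟩
    have := add_mem hc hd
    rwa [show x + y - (c + d) • a = x - c • a + (y - d • a) by module]
  | zero => exact ⟨0, by simp⟩
  | mul x y _ _ _ _ =>
    exact ⟨0, by simpa using mul_mem_lowerPow_succ_left x (mem_lowerPow_zero y)⟩
  | smul r x _ hx =>
    obtain ⟨c, hc⟩ := hx
    refine ⟨r * c, ?_⟩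
    have := Submodule.smul_mem _ r hc
    rwa [show r • x - (r * c) • a = r • (x - c • a) by module]

/-- Modulo `L 1` every factor is a multiple of `a`, and `L 1 * L n` and `L n * L 1` lie in `L
(n+2)`. Thus only products of `V` with `a` itself contribute new directions. -/
theorem lowerPow_succ_le_sup (h : IsNovikov A) {a : A}
    (ha : NonUnitalAlgebra.adjoin ℂ {a} = ⊤) {n : ℕ} {V W : Submodule ℂ A}
    (hV : lowerPow A n ≤ V ⊔ lowerPow A (n + 1)) (hl : ∀ v ∈ V, a * v ∈ W)
    (hr : ∀ v ∈ V, v * a ∈ W) : lowerPow A (n + 1) ≤ W ⊔ lowerPow A (n + 2) := by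
  refine lowerPow_succ_le (fun x y hy => ?_) (fun y hy x => ?_)
  · obtain ⟨c, hc⟩ := exists_sub_smul_mem_lowerPow_one ha x
    obtain ⟨v, hv, z, hz, rfl⟩ := Submodule.mem_sup.1 (hV hy)
    have e : x * (v + z) = c • (a * v) + (c • (a * z) + (x - c • a) * (v + z)) := by
      simp only [mul_add, sub_mul, smul_mul_assoc]
      abel
    rw [e]
    refine add_mem (Submodule.mem_sup_left (Submodule.smul_mem _ _ (hl v hv)))
      (Submodule.mem_sup_right (add_mem (Submodule.smul_mem _ _
        (mul_mem_lowerPow_succ_left a hz)) (mul_mem_lowerPow_of_le h hc hy (by omega))))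
  · obtain ⟨c, hc⟩ := exists_sub_smul_mem_lowerPow_one ha x
    obtain ⟨v, hv, z, hz, rfl⟩ := Submodule.mem_sup.1 (hV hy)
    have e : (v + z) * x = c • (v * a) + (c • (z * a) + (v + z) * (x - c • a)) := by
      simp only [add_mul, mul_sub, mul_smul_comm, smul_add]
      abel
    rw [e]
    refine add_mem (Submodule.mem_sup_left (Submodule.smul_mem _ _ (hr v hv)))
      (Submodule.mem_sup_right (add_mem (Submodule.smul_mem _ _
        (mul_mem_lowerPow_succ_right a hz)) (mul_mem_lowerPow_of_le h hy hc (by omega))))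

end LowerPowers

/-! ### Intermediate parametrised tables, products in coordinates, recognition and change of basis
-/

section Tables

noncomputable section

/-- The algebras whose generator `a` satisfies `(a a) a ≡ l (a (a a))` modulo products of length
four, for `l ≠ 0`. -/
def ratioTable (l p q : ℂ) : MulTable :=
  !![e₂, e₃, (2 - l) • e₄ - (p * (3 - l) / 2) • e₅, (3 - 2 * l) • e₅, 0;
     l • e₃ + p • e₄ + q • e₅, l • e₄ + (p * (3 - l) / 2) • e₅, (l * (2 - l)) • e₅, 0, 0;
     l • e₄ + (p * (3 - l) / 2) • e₅, l • e₅, 0, 0, 0;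
     l • e₅, 0, 0, 0, 0;
     0, 0, 0, 0, 0]

/-- The algebras whose generator `a` satisfies `(a a) a ≡ 0` modulo products of length four. -/
def zeroRatioTable (p q α β : ℂ) : MulTable :=
  !![e₂, e₃, (2 : ℂ) • e₄ - (p * (α + β) / 2) • e₅, α • e₅, 0;
     p • e₄ + q • e₅, (p * (α + β) / 2) • e₅, (2 * β) • e₅, 0, 0;
     (p * (α + β) / 2) • e₅, (-(2 * β)) • e₅, 0, 0, 0;
     β • e₅, 0, 0, 0, 0;
     0, 0, 0, 0, 0]

/-- The algebras whose generator `a` satisfies `a (a a) ≡ 0` modulo products of length four. -/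
def inftyRatioTable (p q : ℂ) : MulTable :=
  !![e₂, p • e₄ + q • e₅, e₄, (2 : ℂ) • e₅, 0;
     e₃, (-p) • e₅, -e₅, 0, 0;
     -e₄ - (2 * p) • e₅, 0, 0, 0, 0;
     -e₅, 0, 0, 0, 0;
     0, 0, 0, 0, 0]

/-- The algebras in which the two products of length three of the generator are independent modulo
products of length four. -/
def wideTable (r s t : ℂ) : MulTable :=
  !![e₂, e₃, s • e₅, t • e₅, 0;
     e₄, r • e₅, 0, 0, 0;
     r • e₅, 0, 0, 0, 0;
     (2 * r - t) • e₅, 0, 0, 0, 0;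
     0, 0, 0, 0, 0]

end

open TableAlgebra

variable {A : Type*} [NonUnitalNonAssocRing A] [Module ℂ A]

theorem tableMul_single (T : MulTable) (i j : Fin 5) :
    tableMul T (Pi.single i 1) (Pi.single j 1) = T i j := by
  simp [tableMul, Pi.single_apply]

theorem tableMul_ratioTable (l p q : ℂ) (x y : Fin 5 → ℂ) :
    tableMul (ratioTable l p q) x y =
      ![0, x 0 * y 0, x 0 * y 1 + l * (x 1 * y 0),
        (2 - l) * (x 0 * y 2) + p * (x 1 * y 0) + l * (x 1 * y 1 + x 2 * y 0),
        p * (3 - l) / 2 * (x 1 * y 1 + x 2 * y 0 - x 0 * y 2) + (3 - 2 * l) * (x 0 * y 3) +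
          q * (x 1 * y 0) + l * (2 - l) * (x 1 * y 2) + l * (x 2 * y 1 + x 3 * y 0)] := by
  ext k
  fin_cases k <;> simp [tableMul, Fin.sum_univ_five, ratioTable, e₂, e₃, e₄, e₅] <;> ring

theorem tableMul_zeroRatioTable (p q α β : ℂ) (x y : Fin 5 → ℂ) :
    tableMul (zeroRatioTable p q α β) x y =
      ![0, x 0 * y 0, x 0 * y 1, 2 * (x 0 * y 2) + p * (x 1 * y 0),
        p * (α + β) / 2 * (x 1 * y 1 + x 2 * y 0 - x 0 * y 2) + α * (x 0 * y 3) +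
          q * (x 1 * y 0) + 2 * β * (x 1 * y 2 - x 2 * y 1) + β * (x 3 * y 0)] := by
  ext k
  fin_cases k <;> simp [tableMul, Fin.sum_univ_five, zeroRatioTable, e₂, e₃, e₄, e₅] <;> ring

theorem tableMul_inftyRatioTable (p q : ℂ) (x y : Fin 5 → ℂ) :
    tableMul (inftyRatioTable p q) x y =
      ![0, x 0 * y 0, x 1 * y 0, p * (x 0 * y 1) + x 0 * y 2 - x 2 * y 0,
        q * (x 0 * y 1) + 2 * (x 0 * y 3) - p * (x 1 * y 1) - x 1 * y 2 - 2 * p * (x 2 * y 0) -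
          x 3 * y 0] := by
  ext k
  fin_cases k <;> simp [tableMul, Fin.sum_univ_five, inftyRatioTable, e₂, e₃, e₄, e₅] <;> ring

theorem tableMul_wideTable (r s t : ℂ) (x y : Fin 5 → ℂ) :
    tableMul (wideTable r s t) x y =
      ![0, x 0 * y 0, x 0 * y 1, x 1 * y 0,
        s * (x 0 * y 2) + t * (x 0 * y 3) + r * (x 1 * y 1 + x 2 * y 0) +
          (2 * r - t) * (x 3 * y 0)] := by
  ext k
  fin_cases k <;> simp [tableMul, Fin.sum_univ_five, wideTable, e₂, e₃, e₄, e₅]; ring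

theorem tableMul_N01 (x y : Fin 5 → ℂ) :
    tableMul N01 x y =
      ![0, x 0 * y 0, x 1 * y 0, x 0 * y 1, x 0 * y 2 - x 2 * y 0] := by
  ext k
  fin_cases k <;> simp [tableMul, Fin.sum_univ_five, N01, e₂, e₃, e₄, e₅]; ring

theorem tableMul_N02 (l : ℂ) (x y : Fin 5 → ℂ) :
    tableMul (N02 l) x y =
      ![0, x 0 * y 0, x 0 * y 1 + l * (x 1 * y 0), x 1 * y 0,
        (2 - l) * (x 0 * y 2) + l * (x 1 * y 1 + x 2 * y 0)] := by
  ext k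
  fin_cases k <;> simp [tableMul, Fin.sum_univ_five, N02, e₂, e₃, e₄, e₅] <;> ring

theorem tableMul_N03 (l m : ℂ) (x y : Fin 5 → ℂ) :
    tableMul (N03 l m) x y =
      ![0, x 0 * y 0, x 0 * y 1, x 1 * y 0,
        l * (x 0 * y 2) + m * (x 0 * y 3) + x 1 * y 1 + x 2 * y 0 + (2 - m) * (x 3 * y 0)] := by
  ext k
  fin_cases k <;> simp [tableMul, Fin.sum_univ_five, N03, e₂, e₃, e₄, e₅]; ring

theorem tableMul_N04 (l : ℂ) (x y : Fin 5 → ℂ) :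
    tableMul (N04 l) x y =
      ![0, x 0 * y 0, x 0 * y 1, x 1 * y 0, x 0 * y 2 + l * (x 0 * y 3 - x 3 * y 0)] := by
  ext k
  fin_cases k <;> simp [tableMul, Fin.sum_univ_five, N04, e₂, e₃, e₄, e₅]; ring

theorem tableMul_N05 (x y : Fin 5 → ℂ) :
    tableMul N05 x y =
      ![0, x 0 * y 0, x 1 * y 0, x 0 * y 2 - x 2 * y 0,
        2 * (x 0 * y 3) - x 1 * y 2 - x 3 * y 0] := by
  ext k
  fin_cases k <;> simp [tableMul, Fin.sum_univ_five, N05, e₂, e₃, e₄, e₅] <;> ring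

theorem tableMul_N06 (x y : Fin 5 → ℂ) :
    tableMul N06 x y =
      ![0, x 0 * y 0, x 1 * y 0, x 0 * y 2 - x 2 * y 0,
        x 0 * y 1 + 2 * (x 0 * y 3) - x 1 * y 2 - x 3 * y 0] := by
  ext k
  fin_cases k <;> simp [tableMul, Fin.sum_univ_five, N06, e₂, e₃, e₄, e₅] <;> ring

theorem tableMul_N07 (l : ℂ) (x y : Fin 5 → ℂ) :
    tableMul (N07 l) x y =
      ![0, x 0 * y 0, x 0 * y 1 + l * (x 1 * y 0),
        (2 - l) * (x 0 * y 2) + l * (x 1 * y 1 + x 2 * y 0),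
        (3 - 2 * l) * (x 0 * y 3) + l * (2 - l) * (x 1 * y 2) +
          l * (x 2 * y 1 + x 3 * y 0)] := by
  ext k
  fin_cases k <;> simp [tableMul, Fin.sum_univ_five, N07, e₂, e₃, e₄, e₅] <;> ring

theorem tableMul_N08 (x y : Fin 5 → ℂ) :
    tableMul N08 x y = ![0, x 0 * y 0, x 0 * y 1, x 0 * y 2, x 0 * y 3 + x 1 * y 0] := by
  ext k
  fin_cases k <;> simp [tableMul, Fin.sum_univ_five, N08, e₂, e₃, e₄, e₅]

theorem tableMul_N09 (l : ℂ) (x y : Fin 5 → ℂ) :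
    tableMul (N09 l) x y =
      ![0, x 0 * y 0, x 0 * y 1, 2 * (x 0 * y 2),
        l * (x 0 * y 3) + 2 * (x 1 * y 2 - x 2 * y 1) + x 3 * y 0] := by
  ext k
  fin_cases k <;> simp [tableMul, Fin.sum_univ_five, N09, e₂, e₃, e₄, e₅] <;> ring

theorem tableMul_N10 (x y : Fin 5 → ℂ) :
    tableMul N10 x y =
      ![0, x 0 * y 0, x 0 * y 1 + x 1 * y 0, x 0 * y 2 + x 1 * y 1 + x 2 * y 0,
        x 0 * y 3 + x 1 * y 0 + x 1 * y 2 + x 2 * y 1 + x 3 * y 0] := by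
  ext k
  fin_cases k <;> simp [tableMul, Fin.sum_univ_five, N10, e₂, e₃, e₄, e₅]; ring

theorem tableMul_N11 (l : ℂ) (x y : Fin 5 → ℂ) :
    tableMul (N11 l) x y =
      ![0, x 0 * y 0, x 0 * y 1, 2 * (x 0 * y 2) + x 1 * y 0,
        l * (x 0 * y 2) + 2 * (x 0 * y 3) + x 1 * y 1 + x 2 * y 0] := by
  ext k
  fin_cases k <;> simp [tableMul, Fin.sum_univ_five, N11, e₂, e₃, e₄, e₅] <;> ring

theorem tableMul_N12 (l : ℂ) (x y : Fin 5 → ℂ) :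
    tableMul (N12 l) x y =
      ![0, x 0 * y 0, x 0 * y 1, 2 * (x 0 * y 2) + x 1 * y 0,
        (2 * l + 1) * (x 0 * y 3) + l * (x 1 * y 1 + x 2 * y 0) -
          2 * (x 1 * y 2 - x 2 * y 1) - x 3 * y 0] := by
  ext k
  fin_cases k <;> simp [tableMul, Fin.sum_univ_five, N12, e₂, e₃, e₄, e₅] <;> ring

theorem tableMul_N13 (l : ℂ) (x y : Fin 5 → ℂ) :
    tableMul (N13 l) x y =
      ![0, x 0 * y 0, x 0 * y 1 + x 1 * y 0, x 0 * y 2 + x 1 * y 0 + x 1 * y 1 + x 2 * y 0,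
        x 0 * y 3 - 2 * (x 0 * y 2) + l * (x 1 * y 0) + x 1 * y 2 + x 2 * y 1 + x 3 * y 0] := by
  ext k
  fin_cases k <;> simp [tableMul, Fin.sum_univ_five, N13, e₂, e₃, e₄, e₅] <;> ring

theorem IsoToTable.of_span {T : MulTable} (hA : Module.finrank ℂ A = 5)
    [IsScalarTower ℂ A A] [SMulCommClass ℂ A A] (v : Fin 5 → A)
    (hv : ⊤ ≤ Submodule.span ℂ (Set.range v))
    (hmul : ∀ i j, v i * v j = ∑ k, T i j k • v k) : IsoToTable A T := by
  let b := basisOfTopLeSpanOfCardEqFinrank v hv (by simp [hA])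
  have hb : ⇑b = v := coe_basisOfTopLeSpanOfCardEqFinrank v hv (by simp [hA])
  have key : ∀ x y : Fin 5 → ℂ,
      b.equivFun.symm (tableMul T x y) = b.equivFun.symm x * b.equivFun.symm y := by
    intro x y
    simp only [Module.Basis.equivFun_symm_apply, hb, Finset.sum_mul_sum, smul_mul_smul_comm, hmul]
    simp only [tableMul, Finset.sum_apply, Pi.smul_apply, smul_eq_mul, Finset.sum_smul,
      Finset.smul_sum, smul_smul]
    rw [Finset.sum_comm]
    refine Finset.sum_congr rfl fun i _ => ?_
    rw [Finset.sum_comm]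
  let e : TableAlgebra T ≃ₗ[ℂ] A := b.equivFun.symm
  have he : ∀ x y : TableAlgebra T, e (x * y) = e x * e y := key
  refine ⟨e.symm, fun x y => e.injective ?_⟩
  rw [he]
  simp only [LinearEquiv.apply_symm_apply]

/-- `M` goes from `T'`-coordinates to `T`-coordinates: its columns are the new basis vectors written
in the old basis. -/
theorem IsoToTable.change_of_det {T T' : MulTable} (h : IsoToTable A T)
    (M : Matrix (Fin 5) (Fin 5) ℂ) (hM : IsUnit M.det)
    (hmul : ∀ x y, tableMul T (M.mulVec x) (M.mulVec y) = M.mulVec (tableMul T' x y)) :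
    IsoToTable A T' := by
  obtain ⟨f, hf⟩ := h
  let g : TableAlgebra T' ≃ₗ[ℂ] TableAlgebra T :=
    Matrix.toLinearEquiv' M ((Matrix.isUnit_iff_isUnit_det M).2 hM).invertible
  have hg : ∀ x y : TableAlgebra T', g (x * y) = g x * g y := fun x y => (hmul x y).symm
  refine ⟨f.trans g.symm, fun x y => ?_⟩
  apply g.injective
  rw [hg]
  simp [hf]

theorem IsoToTable.change {T T' : MulTable} (h : IsoToTable A T)
    (M : Matrix (Fin 5) (Fin 5) ℂ) (hM : M.IsLowerTriangular) (hd : ∀ i, M i i ≠ 0)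
    (hmul : ∀ x y, tableMul T (M.mulVec x) (M.mulVec y) = M.mulVec (tableMul T' x y)) :
    IsoToTable A T' := by
  refine h.change_of_det M ?_ hmul
  rw [Matrix.det_of_isLowerTriangular M hM]
  exact (Finset.prod_ne_zero_iff.2 fun i _ => hd i).isUnit

end Tables

/-! ### Explicit changes of generator and rescalings -/

section BaseChanges

open TableAlgebra

variable {A : Type*} [NonUnitalNonAssocRing A] [Module ℂ A]

theorem isLowerTriangular_of_fin_five {M : Matrix (Fin 5) (Fin 5) ℂ} (h01 : M 0 1 = 0)
    (h02 : M 0 2 = 0) (h03 : M 0 3 = 0) (h04 : M 0 4 = 0) (h12 : M 1 2 = 0) (h13 : M 1 3 = 0)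
    (h14 : M 1 4 = 0) (h23 : M 2 3 = 0) (h24 : M 2 4 = 0) (h34 : M 3 4 = 0) :
    M.IsLowerTriangular := by
  intro i j hij
  rw [OrderDual.toDual_lt_toDual] at hij
  fin_cases i <;> fin_cases j <;> first | assumption | exact absurd hij (by decide)

theorem mulVec_fin_five (M : Matrix (Fin 5) (Fin 5) ℂ) (x : Fin 5 → ℂ) :
    M.mulVec x = fun i => M i 0 * x 0 + M i 1 * x 1 + M i 2 * x 2 + M i 3 * x 3 + M i 4 * x 4 := by
  ext i
  simp [Matrix.mulVec, dotProduct, Fin.sum_univ_five]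

/-- The new generator is `e₁ + s e₂`, and the other columns come from its products. The long last
parameter is the `e₅`-coefficient of the new `e₂e₁` after the `e₅`-parts of `l` times the new `e₃`
and of the new `p` times the new `e₄` are subtracted; only the change of `p` is of interest. -/
theorem IsoToTable.ratioTable_shift {l p q : ℂ}
    (s : ℂ)
    (h : IsoToTable A (ratioTable l p q)) : IsoToTable A (ratioTable l (p + s * l ^ 2 * (l - 1))
      ((q + s * (p * (3 - l) / 2) + s * (1 + l) * (p * (3 - l) / 2) + s ^ 2 * (1 + l) * l + (s * p + s ^ 2 * l) * l) - l * (-(s * (1 + l) * (p * (3 - l) / 2)) + (s * p + s ^ 2 * l) * (3 - 2 * l) + s * (p * (3 - l) / 2) + s ^ 2 * (1 + l) * l * (2 - l)) - (p + s * l ^ 2 * (l - 1)) * ((3 - l) * ((s * (1 + l) * (2 - l) + s * l) + s * l) / 2))) := by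
  refine h.change
    !![1, 0, 0, 0, 0;
       s, 1, 0, 0, 0;
       0, s * (1 + l), 1, 0, 0;
       0, (s * p + s ^ 2 * l), (s * (1 + l) * (2 - l) + s * l), 1, 0;
       0, (s * q + s ^ 2 * (p * (3 - l) / 2)), (-(s * (1 + l) * (p * (3 - l) / 2)) + (s * p + s ^ 2 * l) * (3 - 2 * l) + s * (p * (3 - l) / 2) + s ^ 2 * (1 + l) * l * (2 - l)), ((3 - l) * ((s * (1 + l) * (2 - l) + s * l) + s * l) / 2), 1]
    (by apply isLowerTriangular_of_fin_five <;> rfl)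
    (fun i => by fin_cases i <;> simp) fun x y => ?_
  simp only [tableMul_ratioTable, tableMul_ratioTable, mulVec_fin_five]
  ext k
  fin_cases k <;> simp <;> ring

/-- The new generator is `e₁ + w e₃`. It moves `q` without disturbing `p = 0`. -/
theorem IsoToTable.ratioTable_shift_three {l q : ℂ} (w : ℂ)
    (h : IsoToTable A (ratioTable l 0 q)) : IsoToTable A (ratioTable l 0 (q + 2 * w * l * (l - 1))) := by
  refine h.change
    !![1, 0, 0, 0, 0;
       0, 1, 0, 0, 0;
       w, 0, 1, 0, 0;
       0, 2 * w, 0, 1, 0;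
       0, 0, 2 * w * (3 - 2 * l) + w * l, 0, 1]
    (by apply isLowerTriangular_of_fin_five <;> rfl)
    (fun i => by fin_cases i <;> simp) fun x y => ?_
  simp only [tableMul_ratioTable, tableMul_ratioTable, mulVec_fin_five]
  ext k
  fin_cases k <;> simp <;> ring

theorem IsoToTable.ratioTable_to_N07 {l : ℂ}
    (h : IsoToTable A (ratioTable l 0 0)) : IsoToTable A (N07 l) := by
  refine h.change
    !![1, 0, 0, 0, 0;
       0, 1, 0, 0, 0;
       0, 0, 1, 0, 0;
       0, 0, 0, 1, 0;
       0, 0, 0, 0, 1]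
    (by apply isLowerTriangular_of_fin_five <;> rfl)
    (fun i => by fin_cases i <;> simp) fun x y => ?_
  simp only [tableMul_ratioTable, tableMul_N07, mulVec_fin_five]
  ext k
  fin_cases k <;> simp

theorem IsoToTable.ratioTable_to_N10 {t : ℂ} (ht : t ≠ 0)
    (h : IsoToTable A (ratioTable 1 0 (t ^ 2))) : IsoToTable A N10 := by
  refine h.change
    !![t, 0, 0, 0, 0;
       0, t ^ 2, 0, 0, 0;
       0, 0, t ^ 3, 0, 0;
       0, 0, 0, t ^ 4, 0;
       0, 0, 0, 0, t ^ 5]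
    (by apply isLowerTriangular_of_fin_five <;> rfl)
    (fun i => by fin_cases i <;> simp [ht]) fun x y => ?_
  simp only [tableMul_ratioTable, tableMul_N10, mulVec_fin_five]
  ext k
  fin_cases k <;> simp <;> ring

/-- Besides scaling by powers of `t`, the new `e₄` absorbs the `e₅`-term of `e₂e₂`. This also
produces the `-2` in `e₁e₃` and the shift by one in the parameter. -/
theorem IsoToTable.ratioTable_to_N13 {t u : ℂ} (ht : t ≠ 0)
    (h : IsoToTable A (ratioTable 1 t (t ^ 2 * (u + 1)))) : IsoToTable A (N13 u) := by
  refine h.change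
    !![t, 0, 0, 0, 0;
       0, t ^ 2, 0, 0, 0;
       0, 0, t ^ 3, 0, 0;
       0, 0, 0, t ^ 4, 0;
       0, 0, 0, t ^ 5, t ^ 5]
    (by apply isLowerTriangular_of_fin_five <;> rfl)
    (fun i => by fin_cases i <;> simp [ht]) fun x y => ?_
  simp only [tableMul_ratioTable, tableMul_N13, mulVec_fin_five]
  ext k
  fin_cases k <;> simp <;> ring

theorem IsoToTable.zeroRatioTable_shift_three {p q α β : ℂ} (w : ℂ)
    (h : IsoToTable A (zeroRatioTable p q α β)) : IsoToTable A (zeroRatioTable p (q + 4 * w * β) α β) := by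
  refine h.change
    !![1, 0, 0, 0, 0;
       0, 1, 0, 0, 0;
       w, 0, 1, 0, 0;
       0, 2 * w, 0, 1, 0;
       0, 0, 2 * w * α - 2 * β * w, 0, 1]
    (by apply isLowerTriangular_of_fin_five <;> rfl)
    (fun i => by fin_cases i <;> simp) fun x y => ?_
  simp only [tableMul_zeroRatioTable, tableMul_zeroRatioTable, mulVec_fin_five]
  ext k
  fin_cases k <;> simp <;> ring

theorem IsoToTable.zeroRatioTable_to_N09 {u β : ℂ} (hβ : β ≠ 0)
    (h : IsoToTable A (zeroRatioTable 0 0 (u * β) β)) : IsoToTable A (N09 u) := by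
  refine h.change
    !![1, 0, 0, 0, 0;
       0, 1, 0, 0, 0;
       0, 0, 1, 0, 0;
       0, 0, 0, 1, 0;
       0, 0, 0, 0, β]
    (by apply isLowerTriangular_of_fin_five <;> rfl)
    (fun i => by fin_cases i <;> simp [hβ]) fun x y => ?_
  simp only [tableMul_zeroRatioTable, tableMul_N09, mulVec_fin_five]
  ext k
  fin_cases k <;> simp; ring

theorem IsoToTable.zeroRatioTable_to_N12 {t u β : ℂ} (ht : t ≠ 0) (hβ : β ≠ 0)
    (h : IsoToTable A (zeroRatioTable t (t ^ 2 * u * β / 2) (-(2 * u + 1) * β) β)) : IsoToTable A (N12 u) := by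
  refine h.change
    !![t, 0, 0, 0, 0;
       0, t ^ 2, 0, 0, 0;
       0, 0, t ^ 3, 0, 0;
       0, 0, 0, t ^ 4, 0;
       0, 0, 0, t ^ 5 * u * β / 2, -(t ^ 5 * β)]
    (by apply isLowerTriangular_of_fin_five <;> rfl)
    (fun i => by fin_cases i <;> simp [ht, hβ]) fun x y => ?_
  simp only [tableMul_zeroRatioTable, tableMul_N12, mulVec_fin_five]
  ext k
  fin_cases k <;> simp <;> ring

theorem IsoToTable.zeroRatioTable_to_N07 {k : ℂ} (hk : k ≠ 0)
    (h : IsoToTable A (zeroRatioTable 0 0 (3 * k) 0)) : IsoToTable A (N07 0) := by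
  refine h.change
    !![1, 0, 0, 0, 0;
       0, 1, 0, 0, 0;
       0, 0, 1, 0, 0;
       0, 0, 0, 1, 0;
       0, 0, 0, 0, k]
    (by apply isLowerTriangular_of_fin_five <;> rfl)
    (fun i => by fin_cases i <;> simp [hk]) fun x y => ?_
  simp only [tableMul_zeroRatioTable, tableMul_N07, mulVec_fin_five]
  ext k
  fin_cases k <;> simp; ring

theorem IsoToTable.zeroRatioTable_to_N08 {t α : ℂ} (ht : t ≠ 0) (hα : α ≠ 0)
    (h : IsoToTable A (zeroRatioTable 0 (2 * α * t ^ 2) α 0)) : IsoToTable A N08 := by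
  refine h.change
    !![t, 0, 0, 0, 0;
       0, t ^ 2, 0, 0, 0;
       0, 0, t ^ 3, 0, 0;
       0, 0, 0, 2 * t ^ 4, 0;
       0, 0, 0, 0, 2 * α * t ^ 5]
    (by apply isLowerTriangular_of_fin_five <;> rfl)
    (fun i => by fin_cases i <;> simp [ht, hα]) fun x y => ?_
  simp only [tableMul_zeroRatioTable, tableMul_N08, mulVec_fin_five]
  ext k
  fin_cases k <;> simp <;> ring

theorem IsoToTable.zeroRatioTable_to_N11 {t u α : ℂ} (ht : t ≠ 0) (hα : α ≠ 0)
    (h : IsoToTable A (zeroRatioTable t (-(u + 1) * t ^ 2 * α / 4) α 0)) : IsoToTable A (N11 u) := by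
  refine h.change
    !![t, 0, 0, 0, 0;
       0, t ^ 2, 0, 0, 0;
       0, 0, t ^ 3, 0, 0;
       0, 0, 0, t ^ 4, 0;
       0, 0, 0, -(u + 1) * t ^ 5 * α / 4, t ^ 5 * α / 2]
    (by apply isLowerTriangular_of_fin_five <;> rfl)
    (fun i => by fin_cases i <;> simp [ht, hα]) fun x y => ?_
  simp only [tableMul_zeroRatioTable, tableMul_N11, mulVec_fin_five]
  ext k
  fin_cases k <;> simp <;> ring

/-- The generator `e₁ - p e₂` cancels the `e₄`-term of `e₁e₂`. -/
theorem IsoToTable.inftyRatioTable_shift {p q : ℂ}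
    (h : IsoToTable A (inftyRatioTable p q)) : IsoToTable A (inftyRatioTable 0 (q - 2 * p ^ 2)) := by
  refine h.change
    !![1, 0, 0, 0, 0;
       -p, 1, 0, 0, 0;
       0, -p, 1, 0, 0;
       0, -p ^ 2, p, 1, 0;
       0, -(p * q) - p ^ 3, 4 * p ^ 2, 3 * p, 1]
    (by apply isLowerTriangular_of_fin_five <;> rfl)
    (fun i => by fin_cases i <;> simp) fun x y => ?_
  simp only [tableMul_inftyRatioTable, tableMul_inftyRatioTable, mulVec_fin_five]
  ext k
  fin_cases k <;> simp <;> ring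

theorem IsoToTable.inftyRatioTable_to_N05 
    (h : IsoToTable A (inftyRatioTable 0 0)) : IsoToTable A N05 := by
  refine h.change
    !![1, 0, 0, 0, 0;
       0, 1, 0, 0, 0;
       0, 0, 1, 0, 0;
       0, 0, 0, 1, 0;
       0, 0, 0, 0, 1]
    (by apply isLowerTriangular_of_fin_five <;> rfl)
    (fun i => by fin_cases i <;> simp) fun x y => ?_
  simp only [tableMul_inftyRatioTable, tableMul_N05, mulVec_fin_five]
  ext k
  fin_cases k <;> simp

theorem IsoToTable.inftyRatioTable_to_N06 {t : ℂ} (ht : t ≠ 0)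
    (h : IsoToTable A (inftyRatioTable 0 (t ^ 2))) : IsoToTable A N06 := by
  refine h.change
    !![t, 0, 0, 0, 0;
       0, t ^ 2, 0, 0, 0;
       0, 0, t ^ 3, 0, 0;
       0, 0, 0, t ^ 4, 0;
       0, 0, 0, 0, t ^ 5]
    (by apply isLowerTriangular_of_fin_five <;> rfl)
    (fun i => by fin_cases i <;> simp [ht]) fun x y => ?_
  simp only [tableMul_inftyRatioTable, tableMul_N06, mulVec_fin_five]
  ext k
  fin_cases k <;> simp <;> ring

theorem IsoToTable.wideTable_to_N03 {r l m : ℂ} (hr : r ≠ 0)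
    (h : IsoToTable A (wideTable r (r * l) (r * m))) : IsoToTable A (N03 l m) := by
  refine h.change
    !![1, 0, 0, 0, 0;
       0, 1, 0, 0, 0;
       0, 0, 1, 0, 0;
       0, 0, 0, 1, 0;
       0, 0, 0, 0, r]
    (by apply isLowerTriangular_of_fin_five <;> rfl)
    (fun i => by fin_cases i <;> simp [hr]) fun x y => ?_
  simp only [tableMul_wideTable, tableMul_N03, mulVec_fin_five]
  ext k
  fin_cases k <;> simp; ring

theorem IsoToTable.wideTable_to_N04 {s l : ℂ} (hs : s ≠ 0)
    (h : IsoToTable A (wideTable 0 s (s * l))) : IsoToTable A (N04 l) := by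
  refine h.change
    !![1, 0, 0, 0, 0;
       0, 1, 0, 0, 0;
       0, 0, 1, 0, 0;
       0, 0, 0, 1, 0;
       0, 0, 0, 0, s]
    (by apply isLowerTriangular_of_fin_five <;> rfl)
    (fun i => by fin_cases i <;> simp [hs]) fun x y => ?_
  simp only [tableMul_wideTable, tableMul_N04, mulVec_fin_five]
  ext k
  fin_cases k <;> simp; ring

theorem IsoToTable.wideTable_to_N02 {k : ℂ} (hk : k ≠ 0)
    (h : IsoToTable A (wideTable 0 (2 * k) 0)) : IsoToTable A (N02 0) := by
  refine h.change
    !![1, 0, 0, 0, 0;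
       0, 1, 0, 0, 0;
       0, 0, 1, 0, 0;
       0, 0, 0, 1, 0;
       0, 0, 0, 0, k]
    (by apply isLowerTriangular_of_fin_five <;> rfl)
    (fun i => by fin_cases i <;> simp [hk]) fun x y => ?_
  simp only [tableMul_wideTable, tableMul_N02, mulVec_fin_five]
  ext k
  fin_cases k <;> simp; ring

/-- Here `e₃` and `e₄` trade places, so the matrix is not triangular and invertibility is read from
the determinant. -/
theorem IsoToTable.wideTable_to_N01 {t : ℂ} (ht : t ≠ 0)
    (h : IsoToTable A (wideTable 0 0 t)) : IsoToTable A N01 := by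
  refine h.change_of_det
    !![1, 0, 0, 0, 0;
       0, 1, 0, 0, 0;
       0, 0, 0, 1, 0;
       0, 0, 1, 0, 0;
       0, 0, 0, 0, t]
    (by simp [Matrix.det_succ_row_zero, Fin.sum_univ_succ, Fin.succAbove, ht]) fun x y => ?_
  simp only [tableMul_wideTable, tableMul_N01, mulVec_fin_five]
  ext k
  fin_cases k <;> simp; ring

end BaseChanges

/-! ### Normalising the parameters of the intermediate tables -/

section Reduction

variable (A : Type*) [NonUnitalNonAssocRing A] [Module ℂ A]

/-- `A` is isomorphic to one of the algebras of the classification. -/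
def IsListed : Prop :=
  IsoToTable A N01 ∨ (∃ l : ℂ, IsoToTable A (N02 l)) ∨ (∃ l m : ℂ, IsoToTable A (N03 l m)) ∨
    (∃ l : ℂ, l ≠ 0 ∧ IsoToTable A (N04 l)) ∨ IsoToTable A N05 ∨ IsoToTable A N06 ∨
    (∃ l : ℂ, IsoToTable A (N07 l)) ∨ IsoToTable A N08 ∨ (∃ l : ℂ, IsoToTable A (N09 l)) ∨
    IsoToTable A N10 ∨ (∃ l : ℂ, IsoToTable A (N11 l)) ∨ (∃ l : ℂ, IsoToTable A (N12 l)) ∨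
    (∃ l : ℂ, IsoToTable A (N13 l))

variable {A}

theorem IsListed.of_N07 {l : ℂ} (h : IsoToTable A (N07 l)) : IsListed A :=
  Or.inr <| Or.inr <| Or.inr <| Or.inr <| Or.inr <| Or.inr <| Or.inl ⟨l, h⟩

theorem IsListed.of_wideTable {r s t : ℂ} (h0 : r ≠ 0 ∨ s ≠ 0 ∨ t ≠ 0)
    (h : IsoToTable A (wideTable r s t)) : IsListed A := by
  by_cases hr : r = 0
  · subst hr
    by_cases hs : s = 0
    · subst hs
      exact Or.inl (h.wideTable_to_N01 (by simpa using h0))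
    · by_cases ht : t = 0
      · subst ht
        -- Only `N02 0` is needed here: for `λ ≠ 0` the product `e₃e₁` of `N02 λ` is nonzero, which
        -- belongs to the branch `r ≠ 0`.
        refine Or.inr (Or.inl ⟨0, IsoToTable.wideTable_to_N02 (k := s / 2) (by simpa using hs) ?_⟩)
        rwa [mul_div_cancel₀ s two_ne_zero]
      · refine Or.inr (Or.inr (Or.inr (Or.inl ⟨t / s, div_ne_zero ht hs, ?_⟩)))
        refine IsoToTable.wideTable_to_N04 hs ?_
        rwa [mul_div_cancel₀ t hs]
  · refine Or.inr (Or.inr (Or.inl ⟨s / r, t / r, IsoToTable.wideTable_to_N03 hr ?_⟩))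
    rwa [mul_div_cancel₀ s hr, mul_div_cancel₀ t hr]

theorem IsListed.of_inftyRatioTable {p q : ℂ} (h : IsoToTable A (inftyRatioTable p q)) :
    IsListed A := by
  have h1 := h.inftyRatioTable_shift
  -- Scaling `eᵢ` by `t ^ i` divides the coefficient of `e₅` in `e₁e₂` by `t ^ 2`, so a square root
  -- normalises it to one.
  obtain ⟨t, ht⟩ := IsAlgClosed.exists_pow_nat_eq (q - 2 * p ^ 2) two_pos
  rw [← ht] at h1
  by_cases h0 : t = 0
  · subst h0
    rw [zero_pow two_ne_zero] at h1
    exact Or.inr <| Or.inr <| Or.inr <| Or.inr <| Or.inl h1.inftyRatioTable_to_N05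
  · exact Or.inr <| Or.inr <| Or.inr <| Or.inr <| Or.inr <| Or.inl
      (h1.inftyRatioTable_to_N06 h0)

/-- For `l ≠ 1` the shift by `e₂` kills `p` and then the shift by `e₃` kills `q`. Both increments
carry the factor `l - 1`, so for `l = 1` only scaling is used, and `p`, `q` decide between `N07 1`,
`N10` and `N13`. -/
theorem IsListed.of_ratioTable {l p q : ℂ} (hl : l ≠ 0)
    (h : IsoToTable A (ratioTable l p q)) : IsListed A := by
  by_cases h1 : l = 1
  · subst h1
    by_cases hp : p = 0
    · subst hp
      obtain ⟨t, rfl⟩ := IsAlgClosed.exists_pow_nat_eq q two_pos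
      by_cases h0 : t = 0
      · subst h0
        rw [zero_pow two_ne_zero] at h
        exact of_N07 h.ratioTable_to_N07
      · exact Or.inr <| Or.inr <| Or.inr <| Or.inr <| Or.inr <| Or.inr <| Or.inr <| Or.inr <|
          Or.inr <| Or.inl (h.ratioTable_to_N10 h0)
    · refine Or.inr <| Or.inr <| Or.inr <| Or.inr <| Or.inr <| Or.inr <| Or.inr <| Or.inr <|
        Or.inr <| Or.inr <| Or.inr <| Or.inr ⟨q / p ^ 2 - 1, IsoToTable.ratioTable_to_N13 hp ?_⟩
      rwa [sub_add_cancel, mul_div_cancel₀ q (pow_ne_zero 2 hp)]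
  · have h1' : l - 1 ≠ 0 := sub_ne_zero.2 h1
    have h2 := h.ratioTable_shift (-p / (l ^ 2 * (l - 1)))
    have e : p + -p / (l ^ 2 * (l - 1)) * l ^ 2 * (l - 1) = 0 := by field_simp; ring
    rw [e] at h2
    -- The exact new value of `q` is forgotten, since the next shift removes it whatever it is.
    obtain ⟨q', h2⟩ : ∃ q', IsoToTable A (ratioTable l 0 q') := ⟨_, h2⟩
    have h3 := h2.ratioTable_shift_three (-q' / (2 * l * (l - 1)))
    have e3 : q' + 2 * (-q' / (2 * l * (l - 1))) * l * (l - 1) = 0 := by field_simp; ring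
    rw [e3] at h3
    exact of_N07 h3.ratioTable_to_N07

/-- If `β ≠ 0`, shifting the generator by a multiple of `e₃` gives `q` any desired value, leaving
`N09` or `N12` according to `p`. If `β = 0` that shift does nothing, and `p`, `q` lead to `N07 0`,
`N08` or `N11`. -/
theorem IsListed.of_zeroRatioTable {p q α β : ℂ} (h0 : α ≠ 0 ∨ β ≠ 0)
    (h : IsoToTable A (zeroRatioTable p q α β)) : IsListed A := by
  by_cases hβ : β = 0
  · subst hβ
    have hα : α ≠ 0 := by simpa using h0
    by_cases hp : p = 0
    · subst hp
      by_cases hq : q = 0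
      · subst hq
        refine of_N07 (IsoToTable.zeroRatioTable_to_N07 (k := α / 3) (by simpa using hα) ?_)
        rwa [mul_div_cancel₀ α three_ne_zero]
      · obtain ⟨t, ht⟩ := IsAlgClosed.exists_pow_nat_eq (q / (2 * α)) two_pos
        have ht0 : t ≠ 0 := by
          rintro rfl
          rw [zero_pow two_ne_zero, eq_comm, div_eq_zero_iff] at ht
          simp_all
        have e : q = 2 * α * t ^ 2 := by rw [ht]; field_simp
        subst e
        exact Or.inr <| Or.inr <| Or.inr <| Or.inr <| Or.inr <| Or.inr <| Or.inr <| Or.inl <|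
          h.zeroRatioTable_to_N08 ht0 hα
    · refine Or.inr <| Or.inr <| Or.inr <| Or.inr <| Or.inr <| Or.inr <| Or.inr <| Or.inr <|
        Or.inr <| Or.inr <| Or.inl ⟨-(4 * q / (p ^ 2 * α)) - 1,
          IsoToTable.zeroRatioTable_to_N11 hp hα ?_⟩
      have e : -(-(4 * q / (p ^ 2 * α)) - 1 + 1) * p ^ 2 * α / 4 = q := by field_simp; ring
      rwa [e]
  · by_cases hp : p = 0
    · subst hp
      have h1 := h.zeroRatioTable_shift_three (-q / (4 * β))
      have e : q + 4 * (-q / (4 * β)) * β = 0 := by field_simp; ring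
      rw [e] at h1
      refine Or.inr <| Or.inr <| Or.inr <| Or.inr <| Or.inr <| Or.inr <| Or.inr <| Or.inr <|
        Or.inl ⟨α / β, IsoToTable.zeroRatioTable_to_N09 hβ ?_⟩
      rwa [div_mul_cancel₀ α hβ]
    -- In `N12 u` the coefficients of `e₁e₄` and `e₄e₁` are in the ratio `2u + 1 : -1`, which
    -- determines `u` from `α : β`.
    · obtain ⟨u, rfl⟩ : ∃ u, α = -(2 * u + 1) * β := ⟨(-α / β - 1) / 2, by field_simp; ring⟩
      -- The relation `e₁e₃ = 2e₄` dictates the `e₅`-part of the new `e₄`; the target value of `q`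
      -- is the one for which `e₂e₁` is exactly this vector.
      have h1 := h.zeroRatioTable_shift_three ((p ^ 2 * u * β / 2 - q) / (4 * β))
      have e : q + 4 * ((p ^ 2 * u * β / 2 - q) / (4 * β)) * β = p ^ 2 * u * β / 2 := by
        field_simp; ring
      rw [e] at h1
      exact Or.inr <| Or.inr <| Or.inr <| Or.inr <| Or.inr <| Or.inr <| Or.inr <| Or.inr <|
        Or.inr <| Or.inr <| Or.inr <| Or.inl ⟨u, h1.zeroRatioTable_to_N12 hp hβ⟩

end Reduction

/-! ### The listed algebras have the required properties -/

section Converse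

open TableAlgebra

/-- Every basis vector but the first is a linear combination of two products of earlier ones. -/
def IsGeneratingTable (T : MulTable) : Prop :=
  ∀ k : Fin 5, k ≠ 0 → ∃ i j i' j' : Fin 5, (i < k ∧ j < k ∧ i' < k ∧ j' < k) ∧
    ∃ r s : ℂ, (Pi.single k 1 : Fin 5 → ℂ) = r • T i j + s • T i' j'

/-- The `k`-th coordinate of a product vanishes if all smaller coordinates of one factor do. -/
def IsTriangularTable (T : MulTable) : Prop :=
  ∀ x y : Fin 5 → ℂ, ∀ k : Fin 5, (∀ i < k, x i = 0) ∨ (∀ i < k, y i = 0) →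
    tableMul T x y k = 0

/-- The Novikov identities for the product given by a table. -/
def IsNovikovTable (T : MulTable) : Prop :=
  (∀ x y z, tableMul T (tableMul T x y) z = tableMul T (tableMul T x z) y) ∧
    ∀ x y z, tableMul T (tableMul T x y) z - tableMul T x (tableMul T y z) =
      tableMul T (tableMul T y x) z - tableMul T y (tableMul T x z)

variable {A : Type*} [NonUnitalNonAssocRing A] [Module ℂ A] {T : MulTable}

theorem IsoToTable.finrank_eq_five (h : IsoToTable A T) : Module.finrank ℂ A = 5 := by
  obtain ⟨f, -⟩ := h
  rw [f.finrank_eq]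
  exact Module.finrank_fin_fun ℂ

theorem IsoToTable.isNovikov (h : IsoToTable A T) (hT : IsNovikovTable T) : IsNovikov A := by
  obtain ⟨f, hf⟩ := h
  refine ⟨fun x y z => f.injective ?_, fun x y z => f.injective ?_⟩
  · simp only [hf]
    exact hT.1 (f x) (f y) (f z)
  · simp only [map_sub, hf]
    exact hT.2 (f x) (f y) (f z)

variable [IsScalarTower ℂ A A] [SMulCommClass ℂ A A]

/-- The vectors whose first `k` coordinates vanish form a filtration on which multiplication by
anything, on either side, gains a step; it reaches zero at `k = 5`. -/
theorem IsoToTable.isNilpotentAlgebra (h : IsoToTable A T) (hT : IsTriangularTable T) :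
    IsNilpotentAlgebra A := by
  obtain ⟨f, hf⟩ := h
  let V : ℕ → Submodule ℂ (TableAlgebra T) := fun k =>
    { carrier := {x | ∀ i : Fin 5, i.val < k → (x : Fin 5 → ℂ) i = 0}
      add_mem' := fun {x y} hx hy i hi => by
        have : (x : Fin 5 → ℂ) i + (y : Fin 5 → ℂ) i = 0 := by rw [hx i hi, hy i hi, add_zero]
        exact this
      zero_mem' := fun _ _ => rfl
      smul_mem' := fun c x hx i hi => by
        have : c * (x : Fin 5 → ℂ) i = 0 := by rw [hx i hi, mul_zero]
        exact this }
  have key := algPow_le_of_filtration (fun k => (V k).comap f.toLinearMap)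
    (eq_top_iff.2 fun x _ i hi => absurd hi (Nat.not_lt_zero _)) ?_ ?_ 5 _ le_rfl
  · refine ⟨2 ^ 5, eq_bot_iff.2 (key.trans fun x hx => ?_)⟩
    rw [Submodule.mem_bot]
    apply f.injective
    rw [map_zero]
    exact funext fun i => hx i i.2
  · intro k x y hy i hi
    have : tableMul T (f x) (f y) i = 0 :=
      hT _ _ i (Or.inr fun j hj => hy j (by have : j.val < i.val := hj; omega))
    have e : f.toLinearMap (x * y) = f x * f y := hf x y
    rw [e]
    exact this
  · intro k x y hx i hi
    have : tableMul T (f x) (f y) i = 0 :=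
      hT _ _ i (Or.inl fun j hj => hx j (by have : j.val < i.val := hj; omega))
    have e : f.toLinearMap (x * y) = f x * f y := hf x y
    rw [e]
    exact this

theorem IsoToTable.isOneGenerated (h : IsoToTable A T) (hT : IsGeneratingTable T) :
    IsOneGenerated A := by
  obtain ⟨f, hf⟩ := h
  let g : (Fin 5 → ℂ) →ₗ[ℂ] A := f.symm.toLinearMap
  have hg : ∀ x y, g (tableMul T x y) = g x * g y := by
    intro x y
    apply f.injective
    rw [hf]
    exact (f.apply_symm_apply (tableMul T x y)).trans
      (congrArg₂ (tableMul T) (f.apply_symm_apply x).symm (f.apply_symm_apply y).symm)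
  refine ⟨g (Pi.single 0 1), ?_⟩
  set S := NonUnitalAlgebra.adjoin ℂ {g (Pi.single 0 1)} with hS
  have key : ∀ n : ℕ, ∀ k : Fin 5, k.val = n → g (Pi.single k 1) ∈ S := by
    intro n
    induction n using Nat.strong_induction_on with
    | _ n ih =>
      intro k hk
      by_cases h0 : k = 0
      · rw [h0]
        exact NonUnitalAlgebra.subset_adjoin ℂ rfl
      · obtain ⟨i, j, i', j', ⟨h1, h2, h3, h4⟩, r, s, e⟩ := hT k h0
        rw [← tableMul_single T i j, ← tableMul_single T i' j'] at e
        rw [e, map_add, map_smul, map_smul, hg, hg]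
        have hlt : ∀ m < k, g (Pi.single m 1) ∈ S := fun m hm =>
          ih m (hk ▸ hm) m rfl
        exact add_mem (S.toSubmodule.smul_mem r (S.mul_mem (hlt i h1) (hlt j h2)))
          (S.toSubmodule.smul_mem s (S.mul_mem (hlt i' h3) (hlt j' h4)))
  refine eq_top_iff.2 fun x _ => ?_
  have e : x = g (f x) := (f.symm_apply_apply x).symm
  rw [e, pi_eq_sum_univ' (R := ℂ) (f x : Fin 5 → ℂ), map_sum]
  refine sum_mem fun i _ => ?_
  rw [map_smul]
  exact S.toSubmodule.smul_mem _ (key i i rfl)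

theorem IsoToTable.properties (h : IsoToTable A T) (hg : IsGeneratingTable T)
    (ht : IsTriangularTable T) (hn : IsNovikovTable T) :
    Module.finrank ℂ A = 5 ∧ IsOneGenerated A ∧ IsNilpotentAlgebra A ∧ IsNovikov A :=
  ⟨h.finrank_eq_five, h.isOneGenerated hg, h.isNilpotentAlgebra ht, h.isNovikov hn⟩

theorem isGeneratingTable_N01 : IsGeneratingTable N01 := by
  intro k hk
  fin_cases k
  · exact absurd rfl hk
  · exact ⟨0, 0, 0, 0, by decide, 1, 0, by
      ext m; fin_cases m <;> simp [N01, e₂, e₃, e₄, e₅]⟩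
  · exact ⟨1, 0, 1, 0, by decide, 1, 0, by
      ext m; fin_cases m <;> simp [N01, e₂, e₃, e₄, e₅]⟩
  · exact ⟨0, 1, 0, 1, by decide, 1, 0, by
      ext m; fin_cases m <;> simp [N01, e₂, e₃, e₄, e₅]⟩
  · exact ⟨0, 2, 0, 2, by decide, 1, 0, by
      ext m; fin_cases m <;> simp [N01, e₂, e₃, e₄, e₅]⟩

theorem isTriangularTable_N01 : IsTriangularTable N01 := by
  intro x y k h
  rw [tableMul_N01]
  fin_cases k <;> simp only [Fin.forall_fin_succ] at h <;> rcases h with h | h <;> simp_all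

theorem isNovikovTable_N01 : IsNovikovTable N01 := by
  constructor <;> intro x y z <;> simp only [tableMul_N01] <;> ext k <;>
    fin_cases k <;> simp [-mul_eq_mul_left_iff, -mul_eq_mul_right_iff] <;> ring

theorem isGeneratingTable_N02 (l : ℂ) : IsGeneratingTable (N02 l) := by
  intro k hk
  fin_cases k
  · exact absurd rfl hk
  · exact ⟨0, 0, 0, 0, by decide, 1, 0, by
      ext m; fin_cases m <;> simp [N02, e₂, e₃, e₄, e₅]⟩
  · exact ⟨0, 1, 0, 1, by decide, 1, 0, by
      ext m; fin_cases m <;> simp [N02, e₂, e₃, e₄, e₅]⟩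
  · exact ⟨1, 0, 0, 1, by decide, 1, -l, by
      ext m; fin_cases m <;> simp [N02, e₂, e₃, e₄, e₅]⟩
  -- Either of `e₁e₃`, `e₃e₁` may vanish for special `l`, but their coefficients `2 - l` and `l`
  -- always add up to `2`.
  · exact ⟨0, 2, 2, 0, by decide, 1 / 2, 1 / 2, by
      ext m; fin_cases m <;> simp [N02, e₂, e₃, e₄, e₅]; ring⟩

theorem isTriangularTable_N02 (l : ℂ) : IsTriangularTable (N02 l) := by
  intro x y k h
  rw [tableMul_N02]
  fin_cases k <;> simp only [Fin.forall_fin_succ] at h <;> rcases h with h | h <;> simp_all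

theorem isNovikovTable_N02 (l : ℂ) : IsNovikovTable (N02 l) := by
  constructor <;> intro x y z <;> simp only [tableMul_N02] <;> ext k <;>
    fin_cases k <;> simp [-mul_eq_mul_left_iff, -mul_eq_mul_right_iff] <;> ring

theorem isGeneratingTable_N03 (l m : ℂ) : IsGeneratingTable (N03 l m) := by
  intro k hk
  fin_cases k
  · exact absurd rfl hk
  · exact ⟨0, 0, 0, 0, by decide, 1, 0, by
      ext m; fin_cases m <;> simp [N03, e₂, e₃, e₄, e₅]⟩
  · exact ⟨0, 1, 0, 1, by decide, 1, 0, by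
      ext m; fin_cases m <;> simp [N03, e₂, e₃, e₄, e₅]⟩
  · exact ⟨1, 0, 1, 0, by decide, 1, 0, by
      ext m; fin_cases m <;> simp [N03, e₂, e₃, e₄, e₅]⟩
  · exact ⟨1, 1, 1, 1, by decide, 1, 0, by
      ext m; fin_cases m <;> simp [N03, e₂, e₃, e₄, e₅]⟩

theorem isTriangularTable_N03 (l m : ℂ) : IsTriangularTable (N03 l m) := by
  intro x y k h
  rw [tableMul_N03]
  fin_cases k <;> simp only [Fin.forall_fin_succ] at h <;> rcases h with h | h <;> simp_all

theorem isNovikovTable_N03 (l m : ℂ) : IsNovikovTable (N03 l m) := by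
  constructor <;> intro x y z <;> simp only [tableMul_N03] <;> ext k <;>
    fin_cases k <;> simp [-mul_eq_mul_left_iff, -mul_eq_mul_right_iff] <;> ring

theorem isGeneratingTable_N04 (l : ℂ) : IsGeneratingTable (N04 l) := by
  intro k hk
  fin_cases k
  · exact absurd rfl hk
  · exact ⟨0, 0, 0, 0, by decide, 1, 0, by
      ext m; fin_cases m <;> simp [N04, e₂, e₃, e₄, e₅]⟩
  · exact ⟨0, 1, 0, 1, by decide, 1, 0, by
      ext m; fin_cases m <;> simp [N04, e₂, e₃, e₄, e₅]⟩
  · exact ⟨1, 0, 1, 0, by decide, 1, 0, by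
      ext m; fin_cases m <;> simp [N04, e₂, e₃, e₄, e₅]⟩
  · exact ⟨0, 2, 0, 2, by decide, 1, 0, by
      ext m; fin_cases m <;> simp [N04, e₂, e₃, e₄, e₅]⟩

theorem isTriangularTable_N04 (l : ℂ) : IsTriangularTable (N04 l) := by
  intro x y k h
  rw [tableMul_N04]
  fin_cases k <;> simp only [Fin.forall_fin_succ] at h <;> rcases h with h | h <;> simp_all

theorem isNovikovTable_N04 (l : ℂ) : IsNovikovTable (N04 l) := by
  constructor <;> intro x y z <;> simp only [tableMul_N04] <;> ext k <;>
    fin_cases k <;> simp [-mul_eq_mul_left_iff, -mul_eq_mul_right_iff] <;> ring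

theorem isGeneratingTable_N05 : IsGeneratingTable N05 := by
  intro k hk
  fin_cases k
  · exact absurd rfl hk
  · exact ⟨0, 0, 0, 0, by decide, 1, 0, by
      ext m; fin_cases m <;> simp [N05, e₂, e₃, e₄, e₅]⟩
  · exact ⟨1, 0, 1, 0, by decide, 1, 0, by
      ext m; fin_cases m <;> simp [N05, e₂, e₃, e₄, e₅]⟩
  · exact ⟨0, 2, 0, 2, by decide, 1, 0, by
      ext m; fin_cases m <;> simp [N05, e₂, e₃, e₄, e₅]⟩
  · exact ⟨3, 0, 3, 0, by decide, -1, 0, by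
      ext m; fin_cases m <;> simp [N05, e₂, e₃, e₄, e₅]⟩

theorem isTriangularTable_N05 : IsTriangularTable N05 := by
  intro x y k h
  rw [tableMul_N05]
  fin_cases k <;> simp only [Fin.forall_fin_succ] at h <;> rcases h with h | h <;> simp_all

theorem isNovikovTable_N05 : IsNovikovTable N05 := by
  constructor <;> intro x y z <;> simp only [tableMul_N05] <;> ext k <;>
    fin_cases k <;> simp [-mul_eq_mul_left_iff, -mul_eq_mul_right_iff] <;> ring

theorem isGeneratingTable_N06 : IsGeneratingTable N06 := by
  intro k hk
  fin_cases k
  · exact absurd rfl hk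
  · exact ⟨0, 0, 0, 0, by decide, 1, 0, by
      ext m; fin_cases m <;> simp [N06, e₂, e₃, e₄, e₅]⟩
  · exact ⟨1, 0, 1, 0, by decide, 1, 0, by
      ext m; fin_cases m <;> simp [N06, e₂, e₃, e₄, e₅]⟩
  · exact ⟨0, 2, 0, 2, by decide, 1, 0, by
      ext m; fin_cases m <;> simp [N06, e₂, e₃, e₄, e₅]⟩
  · exact ⟨3, 0, 3, 0, by decide, -1, 0, by
      ext m; fin_cases m <;> simp [N06, e₂, e₃, e₄, e₅]⟩

theorem isTriangularTable_N06 : IsTriangularTable N06 := by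
  intro x y k h
  rw [tableMul_N06]
  fin_cases k <;> simp only [Fin.forall_fin_succ] at h <;> rcases h with h | h <;> simp_all

theorem isNovikovTable_N06 : IsNovikovTable N06 := by
  constructor <;> intro x y z <;> simp only [tableMul_N06] <;> ext k <;>
    fin_cases k <;> simp [-mul_eq_mul_left_iff, -mul_eq_mul_right_iff] <;> ring

theorem isGeneratingTable_N07 (l : ℂ) : IsGeneratingTable (N07 l) := by
  intro k hk
  fin_cases k
  · exact absurd rfl hk
  · exact ⟨0, 0, 0, 0, by decide, 1, 0, by
      ext m; fin_cases m <;> simp [N07, e₂, e₃, e₄, e₅]⟩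
  · exact ⟨0, 1, 0, 1, by decide, 1, 0, by
      ext m; fin_cases m <;> simp [N07, e₂, e₃, e₄, e₅]⟩
  · exact ⟨0, 2, 2, 0, by decide, 1 / 2, 1 / 2, by
      ext m; fin_cases m <;> simp [N07, e₂, e₃, e₄, e₅]; ring⟩
  -- The weights are chosen so that `(3 - 2l) + 2l = 3` is independent of `l`.
  · exact ⟨0, 3, 3, 0, by decide, 1 / 3, 2 / 3, by
      ext m; fin_cases m <;> simp [N07, e₂, e₃, e₄, e₅]; ring⟩

theorem isTriangularTable_N07 (l : ℂ) : IsTriangularTable (N07 l) := by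
  intro x y k h
  rw [tableMul_N07]
  fin_cases k <;> simp only [Fin.forall_fin_succ] at h <;> rcases h with h | h <;> simp_all

theorem isNovikovTable_N07 (l : ℂ) : IsNovikovTable (N07 l) := by
  constructor <;> intro x y z <;> simp only [tableMul_N07] <;> ext k <;>
    fin_cases k <;> simp [-mul_eq_mul_left_iff, -mul_eq_mul_right_iff] <;> ring

theorem isGeneratingTable_N08 : IsGeneratingTable N08 := by
  intro k hk
  fin_cases k
  · exact absurd rfl hk
  · exact ⟨0, 0, 0, 0, by decide, 1, 0, by
      ext m; fin_cases m <;> simp [N08, e₂, e₃, e₄, e₅]⟩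
  · exact ⟨0, 1, 0, 1, by decide, 1, 0, by
      ext m; fin_cases m <;> simp [N08, e₂, e₃, e₄, e₅]⟩
  · exact ⟨0, 2, 0, 2, by decide, 1, 0, by
      ext m; fin_cases m <;> simp [N08, e₂, e₃, e₄, e₅]⟩
  · exact ⟨0, 3, 0, 3, by decide, 1, 0, by
      ext m; fin_cases m <;> simp [N08, e₂, e₃, e₄, e₅]⟩

theorem isTriangularTable_N08 : IsTriangularTable N08 := by
  intro x y k h
  rw [tableMul_N08]
  fin_cases k <;> simp only [Fin.forall_fin_succ] at h <;> rcases h with h | h <;> simp_all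

theorem isNovikovTable_N08 : IsNovikovTable N08 := by
  constructor <;> intro x y z <;> simp only [tableMul_N08] <;> ext k <;>
    fin_cases k <;> simp [-mul_eq_mul_left_iff, -mul_eq_mul_right_iff] <;> ring

theorem isGeneratingTable_N09 (l : ℂ) : IsGeneratingTable (N09 l) := by
  intro k hk
  fin_cases k
  · exact absurd rfl hk
  · exact ⟨0, 0, 0, 0, by decide, 1, 0, by
      ext m; fin_cases m <;> simp [N09, e₂, e₃, e₄, e₅]⟩
  · exact ⟨0, 1, 0, 1, by decide, 1, 0, by
      ext m; fin_cases m <;> simp [N09, e₂, e₃, e₄, e₅]⟩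
  · exact ⟨0, 2, 0, 2, by decide, 1 / 2, 0, by
      ext m; fin_cases m <;> simp [N09, e₂, e₃, e₄, e₅]⟩
  · exact ⟨3, 0, 3, 0, by decide, 1, 0, by
      ext m; fin_cases m <;> simp [N09, e₂, e₃, e₄, e₅]⟩

theorem isTriangularTable_N09 (l : ℂ) : IsTriangularTable (N09 l) := by
  intro x y k h
  rw [tableMul_N09]
  fin_cases k <;> simp only [Fin.forall_fin_succ] at h <;> rcases h with h | h <;> simp_all

theorem isNovikovTable_N09 (l : ℂ) : IsNovikovTable (N09 l) := by
  constructor <;> intro x y z <;> simp only [tableMul_N09] <;> ext k <;>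
    fin_cases k <;> simp [-mul_eq_mul_left_iff, -mul_eq_mul_right_iff] <;> ring

theorem isGeneratingTable_N10 : IsGeneratingTable N10 := by
  intro k hk
  fin_cases k
  · exact absurd rfl hk
  · exact ⟨0, 0, 0, 0, by decide, 1, 0, by
      ext m; fin_cases m <;> simp [N10, e₂, e₃, e₄, e₅]⟩
  · exact ⟨0, 1, 0, 1, by decide, 1, 0, by
      ext m; fin_cases m <;> simp [N10, e₂, e₃, e₄, e₅]⟩
  · exact ⟨0, 2, 0, 2, by decide, 1, 0, by
      ext m; fin_cases m <;> simp [N10, e₂, e₃, e₄, e₅]⟩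
  · exact ⟨0, 3, 0, 3, by decide, 1, 0, by
      ext m; fin_cases m <;> simp [N10, e₂, e₃, e₄, e₅]⟩

theorem isTriangularTable_N10 : IsTriangularTable N10 := by
  intro x y k h
  rw [tableMul_N10]
  fin_cases k <;> simp only [Fin.forall_fin_succ] at h <;> rcases h with h | h <;> simp_all

theorem isNovikovTable_N10 : IsNovikovTable N10 := by
  constructor <;> intro x y z <;> simp only [tableMul_N10] <;> ext k <;>
    fin_cases k <;> simp [-mul_eq_mul_left_iff, -mul_eq_mul_right_iff] <;> ring

theorem isGeneratingTable_N11 (l : ℂ) : IsGeneratingTable (N11 l) := by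
  intro k hk
  fin_cases k
  · exact absurd rfl hk
  · exact ⟨0, 0, 0, 0, by decide, 1, 0, by
      ext m; fin_cases m <;> simp [N11, e₂, e₃, e₄, e₅]⟩
  · exact ⟨0, 1, 0, 1, by decide, 1, 0, by
      ext m; fin_cases m <;> simp [N11, e₂, e₃, e₄, e₅]⟩
  · exact ⟨1, 0, 1, 0, by decide, 1, 0, by
      ext m; fin_cases m <;> simp [N11, e₂, e₃, e₄, e₅]⟩
  · exact ⟨1, 1, 1, 1, by decide, 1, 0, by
      ext m; fin_cases m <;> simp [N11, e₂, e₃, e₄, e₅]⟩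

theorem isTriangularTable_N11 (l : ℂ) : IsTriangularTable (N11 l) := by
  intro x y k h
  rw [tableMul_N11]
  fin_cases k <;> simp only [Fin.forall_fin_succ] at h <;> rcases h with h | h <;> simp_all

theorem isNovikovTable_N11 (l : ℂ) : IsNovikovTable (N11 l) := by
  constructor <;> intro x y z <;> simp only [tableMul_N11] <;> ext k <;>
    fin_cases k <;> simp [-mul_eq_mul_left_iff, -mul_eq_mul_right_iff] <;> ring

theorem isGeneratingTable_N12 (l : ℂ) : IsGeneratingTable (N12 l) := by
  intro k hk
  fin_cases k
  · exact absurd rfl hk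
  · exact ⟨0, 0, 0, 0, by decide, 1, 0, by
      ext m; fin_cases m <;> simp [N12, e₂, e₃, e₄, e₅]⟩
  · exact ⟨0, 1, 0, 1, by decide, 1, 0, by
      ext m; fin_cases m <;> simp [N12, e₂, e₃, e₄, e₅]⟩
  · exact ⟨1, 0, 1, 0, by decide, 1, 0, by
      ext m; fin_cases m <;> simp [N12, e₂, e₃, e₄, e₅]⟩
  · exact ⟨3, 0, 3, 0, by decide, -1, 0, by
      ext m; fin_cases m <;> simp [N12, e₂, e₃, e₄, e₅]⟩

theorem isTriangularTable_N12 (l : ℂ) : IsTriangularTable (N12 l) := by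
  intro x y k h
  rw [tableMul_N12]
  fin_cases k <;> simp only [Fin.forall_fin_succ] at h <;> rcases h with h | h <;> simp_all

theorem isNovikovTable_N12 (l : ℂ) : IsNovikovTable (N12 l) := by
  constructor <;> intro x y z <;> simp only [tableMul_N12] <;> ext k <;>
    fin_cases k <;> simp [-mul_eq_mul_left_iff, -mul_eq_mul_right_iff] <;> ring

theorem isGeneratingTable_N13 (l : ℂ) : IsGeneratingTable (N13 l) := by
  intro k hk
  fin_cases k
  · exact absurd rfl hk
  · exact ⟨0, 0, 0, 0, by decide, 1, 0, by
      ext m; fin_cases m <;> simp [N13, e₂, e₃, e₄, e₅]⟩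
  · exact ⟨0, 1, 0, 1, by decide, 1, 0, by
      ext m; fin_cases m <;> simp [N13, e₂, e₃, e₄, e₅]⟩
  · exact ⟨2, 0, 2, 0, by decide, 1, 0, by
      ext m; fin_cases m <;> simp [N13, e₂, e₃, e₄, e₅]⟩
  · exact ⟨0, 3, 0, 3, by decide, 1, 0, by
      ext m; fin_cases m <;> simp [N13, e₂, e₃, e₄, e₅]⟩

theorem isTriangularTable_N13 (l : ℂ) : IsTriangularTable (N13 l) := by
  intro x y k h
  rw [tableMul_N13]
  fin_cases k <;> simp only [Fin.forall_fin_succ] at h <;> rcases h with h | h <;> simp_all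

theorem isNovikovTable_N13 (l : ℂ) : IsNovikovTable (N13 l) := by
  constructor <;> intro x y z <;> simp only [tableMul_N13] <;> ext k <;>
    fin_cases k <;> simp [-mul_eq_mul_left_iff, -mul_eq_mul_right_iff] <;> ring

theorem IsListed.properties (h : IsListed A) :
    Module.finrank ℂ A = 5 ∧ IsOneGenerated A ∧ IsNilpotentAlgebra A ∧ IsNovikov A := by
  rcases h with h | ⟨l, h⟩ | ⟨l, m, h⟩ | ⟨l, -, h⟩ | h | h | ⟨l, h⟩ | h | ⟨l, h⟩ | h | ⟨l, h⟩ |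
    ⟨l, h⟩ | ⟨l, h⟩
  · exact h.properties isGeneratingTable_N01 isTriangularTable_N01
      isNovikovTable_N01
  · exact h.properties (isGeneratingTable_N02 l) (isTriangularTable_N02 l)
      (isNovikovTable_N02 l)
  · exact h.properties (isGeneratingTable_N03 l m) (isTriangularTable_N03 l m)
      (isNovikovTable_N03 l m)
  · exact h.properties (isGeneratingTable_N04 l) (isTriangularTable_N04 l)
      (isNovikovTable_N04 l)
  · exact h.properties isGeneratingTable_N05 isTriangularTable_N05
      isNovikovTable_N05
  · exact h.properties isGeneratingTable_N06 isTriangularTable_N06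
      isNovikovTable_N06
  · exact h.properties (isGeneratingTable_N07 l) (isTriangularTable_N07 l)
      (isNovikovTable_N07 l)
  · exact h.properties isGeneratingTable_N08 isTriangularTable_N08
      isNovikovTable_N08
  · exact h.properties (isGeneratingTable_N09 l) (isTriangularTable_N09 l)
      (isNovikovTable_N09 l)
  · exact h.properties isGeneratingTable_N10 isTriangularTable_N10
      isNovikovTable_N10
  · exact h.properties (isGeneratingTable_N11 l) (isTriangularTable_N11 l)
      (isNovikovTable_N11 l)
  · exact h.properties (isGeneratingTable_N12 l) (isTriangularTable_N12 l)
      (isNovikovTable_N12 l)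
  · exact h.properties (isGeneratingTable_N13 l) (isTriangularTable_N13 l)
      (isNovikovTable_N13 l)

end Converse

/-! ### Deriving the multiplication table from the Novikov identities -/

section Structure

variable {A : Type*} [NonUnitalNonAssocRing A] [Module ℂ A]

/-- Left symmetry for `aa, a, a`, with `(aa)(aa) = (a(aa))a` from right commutativity. This is the
relation that ties together the products of length four in all three cases. -/
theorem mul_mul_self_add (h : IsNovikov A) (a : A) :
    a * (a * a * a) + a * a * a * a = (2 : ℂ) • (a * (a * a) * a) := by
  have h1 := h.left_symm (a * a) a a
  have h2 := h.right_comm a a (a * a)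
  rw [h2] at h1
  rw [two_smul]
  rw [sub_eq_sub_iff_add_eq_add] at h1
  rw [add_comm]
  exact h1

variable [IsScalarTower ℂ A A] [SMulCommClass ℂ A A]

/-- With indices from zero, `v i * v j` lies in `L (i+j+1)`, which vanishes for `i + j ≥ 4`; only
ten products remain to be compared. -/
theorem IsoToTable.of_graded_span {T : MulTable} (hA : Module.finrank ℂ A = 5)
    (hN : IsNovikov A) (h5 : lowerPow A 5 = ⊥) (v : Fin 5 → A)
    (hv : ∀ i : Fin 5, v i ∈ lowerPow A i)
    (hspan : ∀ i : Fin 5, lowerPow A i ≤ Submodule.span ℂ {v i} ⊔ lowerPow A (i + 1))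
    (hT : ∀ i j : Fin 5, 4 ≤ i.val + j.val → T i j = 0)
    (hmul : ∀ i j : Fin 5, i.val + j.val < 4 → v i * v j = ∑ k, T i j k • v k) :
    IsoToTable A T := by
  refine IsoToTable.of_span hA v ?_ fun i j => ?_
  · have hle : ∀ i, Submodule.span ℂ {v i} ≤ Submodule.span ℂ (Set.range v) := fun i =>
      Submodule.span_mono (Set.singleton_subset_iff.2 ⟨i, rfl⟩)
    have hb : lowerPow A 5 ≤ Submodule.span ℂ (Set.range v) := h5 ▸ bot_le
    exact (hspan 0).trans (sup_le (hle 0) ((hspan 1).trans (sup_le (hle 1) ((hspan 2).trans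
      (sup_le (hle 2) ((hspan 3).trans (sup_le (hle 3) ((hspan 4).trans
      (sup_le (hle 4) hb)))))))))
  · by_cases h : i.val + j.val < 4
    · exact hmul i j h
    · have h0 : v i * v j ∈ lowerPow A 5 :=
        mul_mem_lowerPow_of_le hN (hv i) (hv j) (by omega)
      rw [h5, Submodule.mem_bot] at h0
      rw [h0, hT i j (by omega)]
      simp

theorem IsoToTable.of_graded_basis {T : MulTable} (hA : Module.finrank ℂ A = 5)
    (hN : IsNovikov A) (h5 : lowerPow A 5 = ⊥) {x₁ x₂ x₃ x₄ x₅ : A} (m1 : x₁ ∈ lowerPow A 0)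
    (m2 : x₂ ∈ lowerPow A 1) (m3 : x₃ ∈ lowerPow A 2) (m4 : x₄ ∈ lowerPow A 3)
    (m5 : x₅ ∈ lowerPow A 4)
    (hspan : ∀ i : Fin 5, lowerPow A i ≤
      Submodule.span ℂ {![x₁, x₂, x₃, x₄, x₅] i} ⊔ lowerPow A (i + 1))
    (hT : ∀ i j : Fin 5, 4 ≤ i.val + j.val → T i j = 0)
    (h11 : x₁ * x₁ = ∑ k, T 0 0 k • ![x₁, x₂, x₃, x₄, x₅] k)
    (h12 : x₁ * x₂ = ∑ k, T 0 1 k • ![x₁, x₂, x₃, x₄, x₅] k)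
    (h13 : x₁ * x₃ = ∑ k, T 0 2 k • ![x₁, x₂, x₃, x₄, x₅] k)
    (h14 : x₁ * x₄ = ∑ k, T 0 3 k • ![x₁, x₂, x₃, x₄, x₅] k)
    (h21 : x₂ * x₁ = ∑ k, T 1 0 k • ![x₁, x₂, x₃, x₄, x₅] k)
    (h22 : x₂ * x₂ = ∑ k, T 1 1 k • ![x₁, x₂, x₃, x₄, x₅] k)
    (h23 : x₂ * x₃ = ∑ k, T 1 2 k • ![x₁, x₂, x₃, x₄, x₅] k)
    (h31 : x₃ * x₁ = ∑ k, T 2 0 k • ![x₁, x₂, x₃, x₄, x₅] k)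
    (h32 : x₃ * x₂ = ∑ k, T 2 1 k • ![x₁, x₂, x₃, x₄, x₅] k)
    (h41 : x₄ * x₁ = ∑ k, T 3 0 k • ![x₁, x₂, x₃, x₄, x₅] k) : IsoToTable A T := by
  refine IsoToTable.of_graded_span hA hN h5 ![x₁, x₂, x₃, x₄, x₅] ?_ hspan hT ?_
  · intro i
    fin_cases i
    exacts [m1, m2, m3, m4, m5]
  · intro i j hij
    fin_cases i <;> fin_cases j <;> first | exact absurd hij (by decide) | assumption

theorem IsoToTable.of_inftyRatio (hA : Module.finrank ℂ A = 5) (hN : IsNovikov A)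
    (h5 : lowerPow A 5 = ⊥) {x₁ x₂ x₃ x₄ x₅ : A} {p q : ℂ} (m1 : x₁ ∈ lowerPow A 0)
    (m2 : x₂ ∈ lowerPow A 1) (m3 : x₃ ∈ lowerPow A 2) (m4 : x₄ ∈ lowerPow A 3)
    (m5 : x₅ ∈ lowerPow A 4)
    (hspan : ∀ i : Fin 5, lowerPow A i ≤
      Submodule.span ℂ {![x₁, x₂, x₃, x₄, x₅] i} ⊔ lowerPow A (i + 1))
    (h11 : x₁ * x₁ = x₂)
    (h12 : x₁ * x₂ = p • x₄ + q • x₅)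
    (h13 : x₁ * x₃ = x₄)
    (h14 : x₁ * x₄ = (2 : ℂ) • x₅)
    (h21 : x₂ * x₁ = x₃)
    (h22 : x₂ * x₂ = (-p) • x₅)
    (h23 : x₂ * x₃ = -x₅)
    (h31 : x₃ * x₁ = -x₄ - (2 * p) • x₅)
    (h32 : x₃ * x₂ = 0)
    (h41 : x₄ * x₁ = -x₅) :
    IsoToTable A (inftyRatioTable p q) := by
  refine IsoToTable.of_graded_basis hA hN h5 m1 m2 m3 m4 m5 hspan (fun i j hij => ?_)
    ?_ ?_ ?_ ?_ ?_ ?_ ?_ ?_ ?_ ?_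
  · fin_cases i <;> fin_cases j <;> first | rfl | exact absurd hij (by decide)
  · rw [h11]; simp [inftyRatioTable, Fin.sum_univ_five, e₂, e₃, e₄, e₅]
  · rw [h12]; simp [inftyRatioTable, Fin.sum_univ_five, e₂, e₃, e₄, e₅]
  · rw [h13]; simp [inftyRatioTable, Fin.sum_univ_five, e₂, e₃, e₄, e₅]
  · rw [h14]; simp [inftyRatioTable, Fin.sum_univ_five, e₂, e₃, e₄, e₅]
  · rw [h21]; simp [inftyRatioTable, Fin.sum_univ_five, e₂, e₃, e₄, e₅]
  · rw [h22]; simp [inftyRatioTable, Fin.sum_univ_five, e₂, e₃, e₄, e₅]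
  · rw [h23]; simp [inftyRatioTable, Fin.sum_univ_five, e₂, e₃, e₄, e₅]
  · rw [h31]; simp [inftyRatioTable, Fin.sum_univ_five, e₂, e₃, e₄, e₅]; module
  · rw [h32]; simp [inftyRatioTable, e₂, e₃, e₄, e₅]
  · rw [h41]; simp [inftyRatioTable, Fin.sum_univ_five, e₂, e₃, e₄, e₅]

theorem IsoToTable.of_zeroRatio (hA : Module.finrank ℂ A = 5) (hN : IsNovikov A)
    (h5 : lowerPow A 5 = ⊥) {x₁ x₂ x₃ x₄ x₅ : A} {p q α β : ℂ} (m1 : x₁ ∈ lowerPow A 0)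
    (m2 : x₂ ∈ lowerPow A 1) (m3 : x₃ ∈ lowerPow A 2) (m4 : x₄ ∈ lowerPow A 3)
    (m5 : x₅ ∈ lowerPow A 4)
    (hspan : ∀ i : Fin 5, lowerPow A i ≤
      Submodule.span ℂ {![x₁, x₂, x₃, x₄, x₅] i} ⊔ lowerPow A (i + 1))
    (h11 : x₁ * x₁ = x₂)
    (h12 : x₁ * x₂ = x₃)
    (h13 : x₁ * x₃ = (2 : ℂ) • x₄ - (p * (α + β) / 2) • x₅)
    (h14 : x₁ * x₄ = α • x₅)
    (h21 : x₂ * x₁ = p • x₄ + q • x₅)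
    (h22 : x₂ * x₂ = (p * (α + β) / 2) • x₅)
    (h23 : x₂ * x₃ = (2 * β) • x₅)
    (h31 : x₃ * x₁ = (p * (α + β) / 2) • x₅)
    (h32 : x₃ * x₂ = (-(2 * β)) • x₅)
    (h41 : x₄ * x₁ = β • x₅) :
    IsoToTable A (zeroRatioTable p q α β) := by
  refine IsoToTable.of_graded_basis hA hN h5 m1 m2 m3 m4 m5 hspan (fun i j hij => ?_)
    ?_ ?_ ?_ ?_ ?_ ?_ ?_ ?_ ?_ ?_
  · fin_cases i <;> fin_cases j <;> first | rfl | exact absurd hij (by decide)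
  · rw [h11]; simp [zeroRatioTable, Fin.sum_univ_five, e₂, e₃, e₄, e₅]
  · rw [h12]; simp [zeroRatioTable, Fin.sum_univ_five, e₂, e₃, e₄, e₅]
  · rw [h13]; simp [zeroRatioTable, Fin.sum_univ_five, e₂, e₃, e₄, e₅]; module
  · rw [h14]; simp [zeroRatioTable, Fin.sum_univ_five, e₂, e₃, e₄, e₅]
  · rw [h21]; simp [zeroRatioTable, Fin.sum_univ_five, e₂, e₃, e₄, e₅]
  · rw [h22]; simp [zeroRatioTable, Fin.sum_univ_five, e₂, e₃, e₄, e₅]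
  · rw [h23]; simp [zeroRatioTable, Fin.sum_univ_five, e₂, e₃, e₄, e₅]
  · rw [h31]; simp [zeroRatioTable, Fin.sum_univ_five, e₂, e₃, e₄, e₅]
  · rw [h32]; simp [zeroRatioTable, Fin.sum_univ_five, e₂, e₃, e₄, e₅]
  · rw [h41]; simp [zeroRatioTable, Fin.sum_univ_five, e₂, e₃, e₄, e₅]

theorem IsoToTable.of_ratio (hA : Module.finrank ℂ A = 5) (hN : IsNovikov A)
    (h5 : lowerPow A 5 = ⊥) {x₁ x₂ x₃ x₄ x₅ : A} {l p q : ℂ} (m1 : x₁ ∈ lowerPow A 0)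
    (m2 : x₂ ∈ lowerPow A 1) (m3 : x₃ ∈ lowerPow A 2) (m4 : x₄ ∈ lowerPow A 3)
    (m5 : x₅ ∈ lowerPow A 4)
    (hspan : ∀ i : Fin 5, lowerPow A i ≤
      Submodule.span ℂ {![x₁, x₂, x₃, x₄, x₅] i} ⊔ lowerPow A (i + 1))
    (h11 : x₁ * x₁ = x₂)
    (h12 : x₁ * x₂ = x₃)
    (h13 : x₁ * x₃ = (2 - l) • x₄ - (p * (3 - l) / 2) • x₅)
    (h14 : x₁ * x₄ = (3 - 2 * l) • x₅)
    (h21 : x₂ * x₁ = l • x₃ + p • x₄ + q • x₅)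
    (h22 : x₂ * x₂ = l • x₄ + (p * (3 - l) / 2) • x₅)
    (h23 : x₂ * x₃ = (l * (2 - l)) • x₅)
    (h31 : x₃ * x₁ = l • x₄ + (p * (3 - l) / 2) • x₅)
    (h32 : x₃ * x₂ = l • x₅)
    (h41 : x₄ * x₁ = l • x₅) :
    IsoToTable A (ratioTable l p q) := by
  refine IsoToTable.of_graded_basis hA hN h5 m1 m2 m3 m4 m5 hspan (fun i j hij => ?_)
    ?_ ?_ ?_ ?_ ?_ ?_ ?_ ?_ ?_ ?_
  · fin_cases i <;> fin_cases j <;> first | rfl | exact absurd hij (by decide)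
  · rw [h11]; simp [ratioTable, Fin.sum_univ_five, e₂, e₃, e₄, e₅]
  · rw [h12]; simp [ratioTable, Fin.sum_univ_five, e₂, e₃, e₄, e₅]
  · rw [h13]; simp [ratioTable, Fin.sum_univ_five, e₂, e₃, e₄, e₅]; module
  · rw [h14]; simp [ratioTable, Fin.sum_univ_five, e₂, e₃, e₄, e₅]
  · rw [h21]; simp [ratioTable, Fin.sum_univ_five, e₂, e₃, e₄, e₅]
  · rw [h22]; simp [ratioTable, Fin.sum_univ_five, e₂, e₃, e₄, e₅]
  · rw [h23]; simp [ratioTable, Fin.sum_univ_five, e₂, e₃, e₄, e₅]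
  · rw [h31]; simp [ratioTable, Fin.sum_univ_five, e₂, e₃, e₄, e₅]
  · rw [h32]; simp [ratioTable, Fin.sum_univ_five, e₂, e₃, e₄, e₅]
  · rw [h41]; simp [ratioTable, Fin.sum_univ_five, e₂, e₃, e₄, e₅]

variable {a : A}

theorem lowerPow_zero_le (ha : NonUnitalAlgebra.adjoin ℂ {a} = ⊤) :
    lowerPow A 0 ≤ Submodule.span ℂ {a} ⊔ lowerPow A 1 := by
  intro x _
  obtain ⟨c, hc⟩ := exists_sub_smul_mem_lowerPow_one ha x
  exact Submodule.mem_sup.2 ⟨c • a, Submodule.smul_mem _ _ (Submodule.mem_span_singleton_self a),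
    _, hc, by abel⟩

theorem lowerPow_succ_le_span_singleton (hN : IsNovikov A)
    (ha : NonUnitalAlgebra.adjoin ℂ {a} = ⊤) {n : ℕ} {v w : A}
    (hV : lowerPow A n ≤ Submodule.span ℂ {v} ⊔ lowerPow A (n + 1))
    (hl : a * v ∈ Submodule.span ℂ {w} ⊔ lowerPow A (n + 2))
    (hr : v * a ∈ Submodule.span ℂ {w} ⊔ lowerPow A (n + 2)) :
    lowerPow A (n + 1) ≤ Submodule.span ℂ {w} ⊔ lowerPow A (n + 2) := by
  have := lowerPow_succ_le_sup hN ha (W := Submodule.span ℂ {w} ⊔ lowerPow A (n + 2)) hV ?_ ?_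
  · rwa [sup_assoc, sup_idem] at this
  · intro x hx
    obtain ⟨c, rfl⟩ := Submodule.mem_span_singleton.1 hx
    rw [mul_smul_comm]
    exact Submodule.smul_mem _ _ hl
  · intro x hx
    obtain ⟨c, rfl⟩ := Submodule.mem_span_singleton.1 hx
    rw [smul_mul_assoc]
    exact Submodule.smul_mem _ _ hr

theorem lowerPow_one_le (hN : IsNovikov A) (ha : NonUnitalAlgebra.adjoin ℂ {a} = ⊤) :
    lowerPow A 1 ≤ Submodule.span ℂ {a * a} ⊔ lowerPow A 2 :=
  have h : a * a ∈ Submodule.span ℂ {a * a} ⊔ lowerPow A 2 :=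
    Submodule.mem_sup_left (Submodule.mem_span_singleton_self _)
  lowerPow_succ_le_span_singleton hN ha (lowerPow_zero_le ha) h h

theorem self_mul_self_mem : a * a ∈ lowerPow A 1 :=
  mul_mem_lowerPow_succ_left a (mem_lowerPow_zero a)

theorem ne_zero_of_span_singleton (hA : Module.finrank ℂ A = 5)
    (h5 : lowerPow A 5 = ⊥) (v : Fin 5 → A)
    (hspan : ∀ i : Fin 5, lowerPow A i ≤ Submodule.span ℂ {v i} ⊔ lowerPow A (i + 1)) :
    v 4 ≠ 0 := by
  have hle : ∀ i, Submodule.span ℂ {v i} ≤ Submodule.span ℂ (Set.range v) := fun i =>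
    Submodule.span_mono (Set.singleton_subset_iff.2 ⟨i, rfl⟩)
  have hb : lowerPow A 5 ≤ Submodule.span ℂ (Set.range v) := h5 ▸ bot_le
  have htop : (⊤ : Submodule ℂ A) ≤ Submodule.span ℂ (Set.range v) :=
    (hspan 0).trans (sup_le (hle 0) ((hspan 1).trans (sup_le (hle 1) ((hspan 2).trans
      (sup_le (hle 2) ((hspan 3).trans (sup_le (hle 3) ((hspan 4).trans
      (sup_le (hle 4) hb)))))))))
  exact (linearIndependent_of_top_le_span_of_card_eq_finrank htop (by simp [hA])).ne_zero 4

theorem isListed_of_infty_ratio (hA : Module.finrank ℂ A = 5) (hN : IsNovikov A)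
    (ha : NonUnitalAlgebra.adjoin ℂ {a} = ⊤) (h5 : lowerPow A 5 = ⊥)
    (hs : lowerPow A 2 ≤ Submodule.span ℂ {a * a * a} ⊔ lowerPow A 3)
    (hc : a * (a * a) ∈ lowerPow A 3) : IsListed A := by
  have hz : ∀ {i j : ℕ} {x y : A}, x ∈ lowerPow A i → y ∈ lowerPow A j → 4 ≤ i + j →
      x * y = 0 := fun hx hy hij => by
    have := mul_mem_lowerPow_of_le hN hx hy (n := 5) (by omega)
    rwa [h5, Submodule.mem_bot] at this
  set e2 := a * a with he2
  set e3 := e2 * a with he3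
  set e4 := a * e3 with he4
  have m1 : a ∈ lowerPow A 0 := mem_lowerPow_zero a
  have m2 : e2 ∈ lowerPow A 1 := self_mul_self_mem
  have m3 : e3 ∈ lowerPow A 2 := mul_mem_lowerPow_succ_right a m2
  have m4 : e4 ∈ lowerPow A 3 := mul_mem_lowerPow_succ_left a m3
  have r22 : e2 * e2 = a * e2 * a := hN.right_comm a a e2
  have hr : a * e2 * a ∈ lowerPow A 4 := mul_mem_lowerPow_succ_right a hc
  have r31 : e3 * a = -e4 + (2 : ℂ) • (a * e2 * a) := by
    rw [← mul_mul_self_add hN a]; abel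
  have r23 : e2 * e3 = e4 * a := hN.right_comm a a e3
  have r32 : e3 * e2 = 0 := by
    rw [he3, hN.right_comm, r22]
    exact hz hr m1 le_rfl
  -- Left symmetry for `e3, a, a`, where `e3 * e2 = 0` and `e3 * a ≡ -e4` modulo `L 4`, whose
  -- elements are killed by `a`.
  have r14 : a * e4 = -((2 : ℂ) • (e4 * a)) := by
    have h1 := hN.left_symm e3 a a
    rw [← he2, r32, r31, ← he4, add_mul, mul_add, smul_mul_assoc, mul_smul_comm,
      hz hr m1 le_rfl, hz m1 hr (by norm_num)] at h1
    simp only [smul_zero, add_zero, sub_zero, neg_mul, mul_neg, sub_neg_eq_add] at h1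
    rw [two_smul, neg_add]
    rw [← sub_eq_iff_eq_add'] at h1
    rw [← h1]; abel
  have s3 : lowerPow A 3 ≤ Submodule.span ℂ {e4} ⊔ lowerPow A 4 := by
    have h4 : e4 ∈ Submodule.span ℂ {e4} ⊔ lowerPow A 4 :=
      Submodule.mem_sup_left (Submodule.mem_span_singleton_self _)
    refine lowerPow_succ_le_span_singleton hN ha hs h4 ?_
    rw [r31]
    exact add_mem (neg_mem h4) (Submodule.mem_sup_right (Submodule.smul_mem _ _ hr))
  set e5 := -(e4 * a) with he5
  have r41 : e4 * a = -e5 := by rw [he5, neg_neg]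
  have m5 : e5 ∈ lowerPow A 4 := neg_mem (mul_mem_lowerPow_succ_right a m4)
  have s4 : lowerPow A 4 ≤ Submodule.span ℂ {e5} ⊔ lowerPow A 5 := by
    have h4 : e5 ∈ Submodule.span ℂ {e5} ⊔ lowerPow A 5 :=
      Submodule.mem_sup_left (Submodule.mem_span_singleton_self _)
    refine lowerPow_succ_le_span_singleton hN ha s3 ?_ ?_
    · rw [r14, r41]
      exact neg_mem (Submodule.smul_mem _ _ (neg_mem h4))
    · rw [r41]
      exact neg_mem h4
  obtain ⟨p, q, hpq⟩ : ∃ p q : ℂ, a * e2 = p • e4 + q • e5 := by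
    rw [h5, sup_bot_eq] at s4
    obtain ⟨x, hx, y, hy, hxy⟩ := Submodule.mem_sup.1 (s3 hc)
    obtain ⟨p, rfl⟩ := Submodule.mem_span_singleton.1 hx
    obtain ⟨q, rfl⟩ := Submodule.mem_span_singleton.1 (s4 hy)
    exact ⟨p, q, hxy.symm⟩
  have hr' : a * e2 * a = (-p) • e5 := by
    rw [hpq, add_mul, smul_mul_assoc, smul_mul_assoc, hz m5 m1 le_rfl, r41]
    simp
  rw [hr'] at r31 r22
  have hspan : ∀ i : Fin 5, lowerPow A i ≤
      Submodule.span ℂ {![a, e2, e3, e4, e5] i} ⊔ lowerPow A (i + 1) := by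
    intro i
    fin_cases i
    exacts [lowerPow_zero_le ha, lowerPow_one_le hN ha, hs, s3, s4]
  exact IsListed.of_inftyRatioTable (IsoToTable.of_inftyRatio hA hN h5 m1 m2 m3 m4 m5 hspan
    rfl hpq rfl (by rw [r14, r41]; module) rfl r22 (by rw [r23, r41])
    (by rw [r31]; module) r32 r41)

theorem isListed_of_ratio (hA : Module.finrank ℂ A = 5) (hN : IsNovikov A)
    (ha : NonUnitalAlgebra.adjoin ℂ {a} = ⊤) (h5 : lowerPow A 5 = ⊥)
    (h4 : Module.finrank ℂ (lowerPow A 4) ≤ 1) {l : ℂ}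
    (hs : lowerPow A 2 ≤ Submodule.span ℂ {a * (a * a)} ⊔ lowerPow A 3)
    (hb : a * a * a - l • (a * (a * a)) ∈ lowerPow A 3) : IsListed A := by
  have : FiniteDimensional ℂ A := Module.finite_of_finrank_pos (by omega)
  have hz : ∀ {i j : ℕ} {x y : A}, x ∈ lowerPow A i → y ∈ lowerPow A j → 4 ≤ i + j →
      x * y = 0 := fun hx hy hij => by
    have := mul_mem_lowerPow_of_le hN hx hy (n := 5) (by omega)
    rwa [h5, Submodule.mem_bot] at this
  set e2 := a * a with he2
  set e3 := a * e2 with he3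
  -- With the symmetric choice, `e3 * a ≡ l e4` and `a * e3 ≡ (2 - l) e4` modulo `L 4`, so `e4`
  -- spans the layer for every `l`.
  set e4 := (2⁻¹ : ℂ) • (a * e3 + e3 * a) with he4
  have m1 : a ∈ lowerPow A 0 := mem_lowerPow_zero a
  have m2 : e2 ∈ lowerPow A 1 := self_mul_self_mem
  have m3 : e3 ∈ lowerPow A 2 := mul_mem_lowerPow_succ_left a m2
  have m4 : e4 ∈ lowerPow A 3 := Submodule.smul_mem _ _
    (add_mem (mul_mem_lowerPow_succ_left a m3) (mul_mem_lowerPow_succ_right a m3))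
  have ma4 : a * e4 ∈ lowerPow A 4 := mul_mem_lowerPow_succ_left a m4
  have m4a : e4 * a ∈ lowerPow A 4 := mul_mem_lowerPow_succ_right a m4
  have r22 : e2 * e2 = e3 * a := hN.right_comm a a e2
  have r13' : a * e3 = (2 : ℂ) • e4 - e3 * a := by rw [he4]; module
  have hsum := mul_mul_self_add hN a
  rw [← he2, ← he3] at hsum
  have s3 : lowerPow A 3 ≤ Submodule.span ℂ {e4} ⊔ lowerPow A 4 := by
    have hx : e3 * a - l • e4 ∈ lowerPow A 4 := by
      have h1 := add_mem (mul_mem_lowerPow_succ_left a hb) (mul_mem_lowerPow_succ_right a hb)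
      have e : e3 * a - l • e4 =
          (2⁻¹ : ℂ) • (a * (e2 * a - l • e3) + (e2 * a - l • e3) * a) := by
        have e' : a * (e2 * a - l • e3) + (e2 * a - l • e3) * a =
            (a * (e2 * a) + e2 * a * a) - l • (a * e3 + e3 * a) := by
          simp only [mul_sub, sub_mul, mul_smul_comm, smul_mul_assoc]
          module
        rw [e', hsum, he4]
        module
      rw [e]
      exact Submodule.smul_mem _ _ h1
    have h3a : e3 * a ∈ Submodule.span ℂ {e4} ⊔ lowerPow A 4 := by
      rw [← sub_add_cancel (e3 * a) (l • e4)]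
      exact add_mem (Submodule.mem_sup_right hx) (Submodule.mem_sup_left
        (Submodule.smul_mem _ _ (Submodule.mem_span_singleton_self _)))
    refine lowerPow_succ_le_span_singleton hN ha hs ?_ h3a
    rw [r13']
    exact sub_mem (Submodule.mem_sup_left
      (Submodule.smul_mem _ _ (Submodule.mem_span_singleton_self _))) h3a
  obtain ⟨p, z, hz4, hbz⟩ : ∃ p : ℂ, ∃ z ∈ lowerPow A 4, e2 * a = l • e3 + p • e4 + z := by
    obtain ⟨x, hx, z, hz, hxz⟩ := Submodule.mem_sup.1 (s3 hb)
    obtain ⟨p, rfl⟩ := Submodule.mem_span_singleton.1 hx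
    exact ⟨p, z, hz, by rw [add_assoc, hxz]; abel⟩
  have r31 : e3 * a = l • e4 + (p / 2) • (a * e4 + e4 * a) := by
    have e : (2 : ℂ) • (e3 * a) = l • (a * e3 + e3 * a) + p • (a * e4 + e4 * a) := by
      rw [← hsum, hbz]
      simp only [mul_add, add_mul, mul_smul_comm, smul_mul_assoc, hz m1 hz4 (by norm_num),
        hz hz4 m1 le_rfl]
      module
    have e' : e3 * a = (2⁻¹ : ℂ) • ((2 : ℂ) • (e3 * a)) := by module
    rw [e', e, he4]
    module
  have r13 : a * e3 = (2 - l) • e4 - (p / 2) • (a * e4 + e4 * a) := by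
    rw [r13', r31]; module
  have hza : ∀ y ∈ lowerPow A 4, y * a = 0 := fun y hy => hz hy m1 le_rfl
  have haz : ∀ y ∈ lowerPow A 4, a * y = 0 := fun y hy => hz m1 hy (by norm_num)
  have r23 : e2 * e3 = (2 - l) • (e4 * a) := by
    rw [he2, hN.right_comm, r13]
    simp only [sub_mul, add_mul, smul_mul_assoc, hza _ ma4, hza _ m4a]
    simp
  have rb2 : e2 * a * e2 = l • (e3 * e2) := by
    rw [hbz]
    simp only [add_mul, smul_mul_assoc, hz m4 m2 le_rfl, hz hz4 m2 (by norm_num)]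
    simp
  -- The product `(e2 * a) * e2` is evaluated twice: by expanding `e2 * a`, and as `(e2 * e2) * a`
  -- by right commutativity.
  have hl : l • (e3 * e2) = l • (e4 * a) := by
    rw [← rb2, hN.right_comm, r22, r31]
    simp only [add_mul, smul_mul_assoc, hza _ ma4, hza _ m4a]
    simp
  have r32 : e3 * e2 = (2 * l - 2) • (e4 * a) + l • (a * e4) := by
    have h1 := hN.left_symm e2 a e2
    rw [rb2, hl, ← he3, r23, r22, r31] at h1
    simp only [mul_add, mul_smul_comm, haz _ ma4, haz _ m4a] at h1
    have h2 : e3 * e2 = l • (e4 * a) - (2 - l) • (e4 * a) + l • (a * e4) := by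
      rw [h1]; simp
    rw [h2]; module
  -- Comparing the two expressions for `l (e3 * e2)` fixes the ratio of `a * e4` to `e4 * a` when `l
  -- ≠ 0`. For `l = 0` it says nothing, whence the two free parameters `α`, `β`.
  have hrel : l • ((3 - 2 * l) • (e4 * a) - l • (a * e4)) = 0 := by
    rw [r32] at hl
    rw [← sub_eq_zero.2 hl.symm]
    module
  have hspan : ∀ e5 : A, lowerPow A 4 ≤ Submodule.span ℂ {e5} ⊔ lowerPow A 5 → ∀ i : Fin 5,
      lowerPow A i ≤ Submodule.span ℂ {![a, e2, e3, e4, e5] i} ⊔ lowerPow A (i + 1) := by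
    intro e5 s4 i
    fin_cases i
    exacts [lowerPow_zero_le ha, lowerPow_one_le hN ha, hs, s3, s4]
  by_cases h0 : l = 0
  · subst h0
    obtain ⟨⟨e5, m5⟩, he5⟩ := finrank_le_one_iff.1 h4
    have hex : ∀ y ∈ lowerPow A 4, ∃ c : ℂ, y = c • e5 := fun y hy => by
      obtain ⟨c, hc⟩ := he5 ⟨y, hy⟩
      exact ⟨c, (congrArg Subtype.val hc).symm⟩
    have s4 : lowerPow A 4 ≤ Submodule.span ℂ {e5} ⊔ lowerPow A 5 := fun y hy => by
      obtain ⟨c, rfl⟩ := hex y hy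
      exact Submodule.mem_sup_left (Submodule.smul_mem _ _ (Submodule.mem_span_singleton_self _))
    obtain ⟨α, hα⟩ := hex _ ma4
    obtain ⟨β, hβ⟩ := hex _ m4a
    obtain ⟨q, rfl⟩ := hex _ hz4
    -- If both vanished, four vectors would span the five-dimensional algebra.
    have hαβ : α ≠ 0 ∨ β ≠ 0 := by
      by_contra! hc
      have s4' : lowerPow A 4 ≤ Submodule.span ℂ {(0 : A)} ⊔ lowerPow A 5 := by
        refine lowerPow_succ_le_span_singleton hN ha s3 ?_ ?_
        · rw [hα, hc.1, zero_smul]; exact zero_mem _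
        · rw [hβ, hc.2, zero_smul]; exact zero_mem _
      exact ne_zero_of_span_singleton hA h5 _ (hspan 0 s4') rfl
    rw [hα, hβ] at r31 r13 r32
    rw [hβ] at r23
    refine IsListed.of_zeroRatioTable hαβ (IsoToTable.of_zeroRatio hA hN h5 (p := p) (q := q)
      m1 m2 m3 m4 m5 (hspan e5 s4) rfl rfl ?_ hα ?_ ?_ ?_ ?_ ?_ hβ)
    · rw [r13]; module
    · rw [hbz]; module
    · rw [r22, r31]; module
    · rw [r23]; module
    · rw [r31]; module
    · rw [r32]; module
  · have hrel' : l • (a * e4) = (3 - 2 * l) • (e4 * a) := by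
      rcases smul_eq_zero.1 hrel with h | h
      · exact absurd h h0
      · exact (sub_eq_zero.1 h).symm
    set e5 := l⁻¹ • (e4 * a) with he5
    have m5 : e5 ∈ lowerPow A 4 := Submodule.smul_mem _ _ m4a
    have hβ : e4 * a = l • e5 := by rw [he5, smul_inv_smul₀ h0]
    have hα : a * e4 = (3 - 2 * l) • e5 := by
      rw [he5, smul_comm, ← hrel', inv_smul_smul₀ h0]
    have s4 : lowerPow A 4 ≤ Submodule.span ℂ {e5} ⊔ lowerPow A 5 := by
      refine lowerPow_succ_le_span_singleton hN ha s3 ?_ ?_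
      · rw [hα]
        exact Submodule.mem_sup_left (Submodule.smul_mem _ _ (Submodule.mem_span_singleton_self _))
      · rw [hβ]
        exact Submodule.mem_sup_left (Submodule.smul_mem _ _ (Submodule.mem_span_singleton_self _))
    obtain ⟨q, rfl⟩ : ∃ q : ℂ, z = q • e5 := by
      have := s4 hz4
      rw [h5, sup_bot_eq] at this
      obtain ⟨q, hq⟩ := Submodule.mem_span_singleton.1 this
      exact ⟨q, hq.symm⟩
    rw [hα, hβ] at r31 r13 r32
    rw [hβ] at r23
    refine IsListed.of_ratioTable h0 (IsoToTable.of_ratio hA hN h5 (p := p) (q := q)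
      m1 m2 m3 m4 m5 (hspan e5 s4) rfl rfl ?_ hα hbz ?_ ?_ ?_ ?_ hβ)
    · rw [r13]; module
    · rw [r22, r31]; module
    · rw [r23]; module
    · rw [r31]; module
    · rw [r32]; module

theorem isListed_of_wide (hA : Module.finrank ℂ A = 5) (hN : IsNovikov A)
    (ha : NonUnitalAlgebra.adjoin ℂ {a} = ⊤) (h4 : lowerPow A 4 = ⊥)
    (h3 : Module.finrank ℂ (lowerPow A 3) ≤ 1)
    (hs : lowerPow A 2 ≤ Submodule.span ℂ {a * (a * a), a * a * a} ⊔ lowerPow A 3) :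
    IsListed A := by
  have : FiniteDimensional ℂ A := Module.finite_of_finrank_pos (by omega)
  have hz : ∀ {i j : ℕ} {x y : A}, x ∈ lowerPow A i → y ∈ lowerPow A j → 3 ≤ i + j →
      x * y = 0 := fun hx hy hij => by
    have := mul_mem_lowerPow_of_le hN hx hy (n := 4) (by omega)
    rwa [h4, Submodule.mem_bot] at this
  set e2 := a * a with he2
  set e3 := a * e2 with he3
  set e4 := e2 * a with he4
  have m1 : a ∈ lowerPow A 0 := mem_lowerPow_zero a
  have m2 : e2 ∈ lowerPow A 1 := self_mul_self_mem
  have m3 : e3 ∈ lowerPow A 2 := mul_mem_lowerPow_succ_left a m2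
  have m4 : e4 ∈ lowerPow A 2 := mul_mem_lowerPow_succ_right a m2
  have r22 : e2 * e2 = e3 * a := hN.right_comm a a e2
  have hsum := mul_mul_self_add hN a
  rw [← he2, ← he3, ← he4] at hsum
  obtain ⟨⟨e5, m5⟩, he5⟩ := finrank_le_one_iff.1 h3
  have hex : ∀ y ∈ lowerPow A 3, ∃ c : ℂ, y = c • e5 := fun y hy => by
    obtain ⟨c, hc⟩ := he5 ⟨y, hy⟩
    exact ⟨c, (congrArg Subtype.val hc).symm⟩
  obtain ⟨r, hr⟩ := hex _ (mul_mem_lowerPow_succ_right a m3)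
  obtain ⟨s, hs'⟩ := hex _ (mul_mem_lowerPow_succ_left a m3)
  obtain ⟨t, ht⟩ := hex _ (mul_mem_lowerPow_succ_left a m4)
  -- The length-four relation expresses this product by two of the others, so three parameters
  -- remain.
  have r41 : e4 * a = (2 * r - t) • e5 := by
    rw [ht, hr] at hsum
    rw [sub_smul, mul_smul, ← hsum]; abel
  have htop : ∀ w : A, lowerPow A 3 ≤ Submodule.span ℂ {w} →
      ⊤ ≤ Submodule.span ℂ (Set.range ![a, e2, e3, e4, w]) := by
    intro w hw
    have hmem : ∀ i, ![a, e2, e3, e4, w] i ∈ Submodule.span ℂ (Set.range ![a, e2, e3, e4, w]) :=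
      fun i => Submodule.subset_span ⟨i, rfl⟩
    refine (lowerPow_zero_le ha).trans (sup_le ?_ ((lowerPow_one_le hN ha).trans
      (sup_le ?_ (hs.trans (sup_le ?_ (hw.trans ?_))))))
    · rw [Submodule.span_singleton_le_iff_mem]; exact hmem 0
    · rw [Submodule.span_singleton_le_iff_mem]; exact hmem 1
    · rw [Submodule.span_le, Set.pair_subset_iff]; exact ⟨hmem 2, hmem 3⟩
    · rw [Submodule.span_singleton_le_iff_mem]; exact hmem 4
  have hw : lowerPow A 3 ≤ Submodule.span ℂ {e5} := fun y hy => by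
    obtain ⟨c, rfl⟩ := hex y hy
    exact Submodule.smul_mem _ _ (Submodule.mem_span_singleton_self _)
  have h0 : r ≠ 0 ∨ s ≠ 0 ∨ t ≠ 0 := by
    by_contra! hc
    obtain ⟨rfl, rfl, rfl⟩ := hc
    simp only [zero_smul, mul_zero, sub_zero] at hr hs' ht r41
    have hw' : lowerPow A 3 ≤ Submodule.span ℂ {(0 : A)} := by
      have := lowerPow_succ_le_sup hN ha (W := ⊥) hs ?_ ?_
      · rw [h4, sup_bot_eq] at this
        exact this.trans bot_le
      · intro x hx
        obtain ⟨c, d, rfl⟩ := Submodule.mem_span_pair.1 hx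
        rw [Submodule.mem_bot, mul_add, mul_smul_comm, mul_smul_comm, hs', ht]
        simp
      · intro x hx
        obtain ⟨c, d, rfl⟩ := Submodule.mem_span_pair.1 hx
        rw [Submodule.mem_bot, add_mul, smul_mul_assoc, smul_mul_assoc, hr, r41]
        simp
    exact (linearIndependent_of_top_le_span_of_card_eq_finrank (htop 0 hw')
      (by simp [hA])).ne_zero 4 rfl
  refine IsListed.of_wideTable h0 (IsoToTable.of_span hA ![a, e2, e3, e4, e5] (htop e5 hw) ?_)
  have z15 := hz m1 m5 le_rfl
  have z51 := hz m5 m1 le_rfl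
  have z23 := hz m2 m3 le_rfl
  have z24 := hz m2 m4 le_rfl
  have z32 := hz m3 m2 le_rfl
  have z42 := hz m4 m2 le_rfl
  have z25 := hz m2 m5 (by norm_num)
  have z52 := hz m5 m2 (by norm_num)
  have z33 := hz m3 m3 (by norm_num)
  have z34 := hz m3 m4 (by norm_num)
  have z43 := hz m4 m3 (by norm_num)
  have z44 := hz m4 m4 (by norm_num)
  have z35 := hz m3 m5 (by norm_num)
  have z53 := hz m5 m3 (by norm_num)
  have z45 := hz m4 m5 (by norm_num)
  have z54 := hz m5 m4 (by norm_num)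
  have z55 := hz m5 m5 (by norm_num)
  intro i j
  fin_cases i <;> fin_cases j <;>
    simp [wideTable, Fin.sum_univ_five, e₂, e₃, e₄, e₅, ← he2, ← he3, ← he4, r22, hr, hs', ht, r41,
      z15, z51, z23, z24, z32, z42, z25, z52, z33, z34, z43, z44, z35, z53, z45, z54, z55]

theorem isListed_of_properties (hA : Module.finrank ℂ A = 5) (hg : IsOneGenerated A)
    (hnil : IsNilpotentAlgebra A) (hN : IsNovikov A) : IsListed A := by
  have : FiniteDimensional ℂ A := Module.finite_of_finrank_pos (by omega)
  obtain ⟨a, ha⟩ := hg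
  have f0 : Module.finrank ℂ (lowerPow A 0) = 5 := (finrank_top ℂ A).trans hA
  have f1 := finrank_lowerPow_succ_le hnil 0
  have f2 := finrank_lowerPow_succ_le hnil 1
  have f3 := finrank_lowerPow_succ_le hnil 2
  have f4 := finrank_lowerPow_succ_le hnil 3
  have f5 := finrank_lowerPow_succ_le hnil 4
  simp only [Nat.reduceAdd] at f1 f2 f3 f4 f5
  have h5 : lowerPow A 5 = ⊥ := Submodule.finrank_eq_zero.1 (by omega)
  have hc : a * (a * a) ∈ lowerPow A 2 := mul_mem_lowerPow_succ_left a self_mul_self_mem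
  have hb : a * a * a ∈ lowerPow A 2 := mul_mem_lowerPow_succ_right a self_mul_self_mem
  have hs : lowerPow A 2 ≤ Submodule.span ℂ {a * (a * a), a * a * a} ⊔ lowerPow A 3 := by
    refine lowerPow_succ_le_sup hN ha (lowerPow_one_le hN ha) ?_ ?_
    · intro x hx
      obtain ⟨c, rfl⟩ := Submodule.mem_span_singleton.1 hx
      rw [mul_smul_comm]
      exact Submodule.smul_mem _ _ (Submodule.subset_span (by simp))
    · intro x hx
      obtain ⟨c, rfl⟩ := Submodule.mem_span_singleton.1 hx
      rw [smul_mul_assoc]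
      exact Submodule.smul_mem _ _ (Submodule.subset_span (by simp))
  by_cases hα : ∃ l : ℂ, a * a * a - l • (a * (a * a)) ∈ lowerPow A 3
  · obtain ⟨l, hl⟩ := hα
    refine isListed_of_ratio hA hN ha h5 (by omega) (hs.trans (sup_le ?_ le_sup_right)) hl
    have h1 : a * (a * a) ∈ Submodule.span ℂ {a * (a * a)} ⊔ lowerPow A 3 :=
      Submodule.mem_sup_left (Submodule.mem_span_singleton_self _)
    rw [Submodule.span_le, Set.pair_subset_iff]
    refine ⟨h1, ?_⟩
    rw [← sub_add_cancel (a * a * a) (l • (a * (a * a)))]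
    exact add_mem (Submodule.mem_sup_right hl) (Submodule.smul_mem _ _ h1)
  by_cases hβ : a * (a * a) ∈ lowerPow A 3
  · refine isListed_of_infty_ratio hA hN ha h5 (hs.trans (sup_le ?_ le_sup_right)) hβ
    rw [Submodule.span_le, Set.pair_subset_iff]
    exact ⟨Submodule.mem_sup_right hβ,
      Submodule.mem_sup_left (Submodule.mem_span_singleton_self _)⟩
  -- Two strict inclusions between `L 3` and `L 2`, with `dim L 2 ≤ 3`, give `dim L 3 ≤ 1` and hence
  -- `L 4 = 0`.
  · have lt1 : lowerPow A 3 < lowerPow A 3 ⊔ Submodule.span ℂ {a * (a * a)} :=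
      left_lt_sup.2 fun h => hβ (h (Submodule.mem_span_singleton_self _))
    have lt2 : lowerPow A 3 ⊔ Submodule.span ℂ {a * (a * a)} < lowerPow A 2 := by
      refine lt_of_le_of_ne (sup_le (lowerPow_succ_le_self 2)
        ((Submodule.span_singleton_le_iff_mem _ _).2 hc)) fun he => hα ?_
      rw [← he] at hb
      obtain ⟨y, hy, x, hx, hxy⟩ := Submodule.mem_sup.1 hb
      obtain ⟨l, rfl⟩ := Submodule.mem_span_singleton.1 hx
      exact ⟨l, by rwa [← hxy, add_sub_cancel_right]⟩
    have g1 := Submodule.finrank_lt_finrank_of_lt lt1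
    have g2 := Submodule.finrank_lt_finrank_of_lt lt2
    exact isListed_of_wide hA hN ha (Submodule.finrank_eq_zero.1 (by omega)) (by omega) hs

end Structure

end NovikovClassification

theorem mainTheorem1 (A : Type*) [NonUnitalNonAssocRing A] [Module ℂ A]
    [IsScalarTower ℂ A A] [SMulCommClass ℂ A A] :
    (Module.finrank ℂ A = 5 ∧ NovikovClassification.IsOneGenerated A ∧
      NovikovClassification.IsNilpotentAlgebra A ∧ NovikovClassification.IsNovikov A) ↔
    (NovikovClassification.IsoToTable A NovikovClassification.N01 ∨
      (∃ l : ℂ, NovikovClassification.IsoToTable A (NovikovClassification.N02 l)) ∨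
      (∃ l m : ℂ, NovikovClassification.IsoToTable A (NovikovClassification.N03 l m)) ∨
      (∃ l : ℂ, l ≠ 0 ∧ NovikovClassification.IsoToTable A (NovikovClassification.N04 l)) ∨
      NovikovClassification.IsoToTable A NovikovClassification.N05 ∨
      NovikovClassification.IsoToTable A NovikovClassification.N06 ∨
      (∃ l : ℂ, NovikovClassification.IsoToTable A (NovikovClassification.N07 l)) ∨
      NovikovClassification.IsoToTable A NovikovClassification.N08 ∨
      (∃ l : ℂ, NovikovClassification.IsoToTable A (NovikovClassification.N09 l)) ∨
      NovikovClassification.IsoToTable A NovikovClassification.N10 ∨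
      (∃ l : ℂ, NovikovClassification.IsoToTable A (NovikovClassification.N11 l)) ∨
      (∃ l : ℂ, NovikovClassification.IsoToTable A (NovikovClassification.N12 l)) ∨
      (∃ l : ℂ, NovikovClassification.IsoToTable A (NovikovClassification.N13 l))) := by
  exact ⟨fun ⟨hA, hg, hnil, hN⟩ =>
    NovikovClassification.isListed_of_properties hA hg hnil hN,
    NovikovClassification.IsListed.properties⟩
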